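/- For each real $\lambda\ge 1$ there exists a constant $c=c(\lambda)>0$ such that the following holds. Let $G$ be a finite simple graph with at least one vertex, with average degree $d=\frac{1}{|V(G)|}\sum_{v\in V(G)}\deg(v)$ and with maximum degree at most $\lambda d$. Then, for every integer $r$ with $0\le r\le cd$, the graph $G$ contains an $r$-regular subgraph, that is, a subgraph with at least one vertex in which every vertex has degree exactly $r$. -/

import Mathlib

/-- The average degree `(∑ v, deg v) / |V|` of a finite graph, as a real number. -/
noncomputable def SimpleGraph.avgDegree {V : Type*} [Fintype V] (G : SimpleGraph V)
    [DecidableRel G.Adj] : ℝ :=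
  (∑ v, (G.degree v : ℝ)) / (Fintype.card V : ℝ)

/-- `G` contains an `r`-regular subgraph: a subgraph (not necessarily induced or spanning)
with at least one vertex, which is, as a graph on its own vertex set, regular of degree `r`. -/
def SimpleGraph.ContainsRegularSubgraph {V : Type*} (G : SimpleGraph V) (r : ℕ) : Prop :=
  ∃ H : G.Subgraph, H.verts.Nonempty ∧
    ∃ _ : H.coe.LocallyFinite, H.coe.IsRegularOfDegree r

/-! A cut keeps half of the edges, and discarding vertices of low degree leaves a bipartite graph
whose degrees lie between `κ D` and `D`, where `D` is `lam` times the average degree and `κ` depends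
only on `lam`. The main point is to make this graph regular up to a bounded average error, using
edge weights.

Keep each vertex `x` with probability about `deg x / D`, and divide the weight of each surviving
edge by the retention probabilities of both ends. A surviving vertex then has expected degree about
`D`; only random fluctuations remain, and trimming removes the excess over `D` at comparable
mean-square cost (`exists_trim`). One round brings the defects `D - deg` down to order `√D`. In
later rounds the retention probabilities are close to 1, so the fluctuations shrink with the
defects: a typical defect of order `u ^ 2` becomes `(u / 2) ^ 2`, while the bounds grow by factors
`1 + O(1 / u)`. Since `u` decreases geometrically these factors have bounded product, and at
constant `u` the average defect is a constant (`exists_bounded_defect`).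

Now take a prime `p` with `r < p ≤ 2 r` and rescale so that degrees are at most `2 p - 1`. For `D`
large against `r`, the average degree exceeds `2 p - 2`. Integrality of the bipartite degree
polytope (`exists_rounding`) yields a genuine subgraph with the same bounds, and the
Chevalley–Warning argument of Alon, Friedland and Kalai finds a `p`-regular subgraph in it. Rounding
the constant weight `r / p` on this subgraph gives degree `r`. -/

/-! ### Expectation over independent coin flips -/

/-- Expectation of `g` when the coordinates `z v` are independent and `z v` is true with
probability `q v`. -/
noncomputable def bernoulliExp {V : Type*} [Fintype V] [DecidableEq V] (q : V → ℝ)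
    (g : (V → Bool) → ℝ) : ℝ :=
  ∑ z : V → Bool, (∏ v, if z v then q v else 1 - q v) * g z

section BernoulliExp

variable {V : Type*} [Fintype V] [DecidableEq V] (q : V → ℝ)

/-- Expanding a product of two-term sums enumerates the outcomes. This is independence; the
coordinate formulas below are specialisations. -/
theorem bernoulliExp_prod_univ (g : V → Bool → ℝ) :
    bernoulliExp q (fun z => ∏ v, g v (z v)) =
      ∏ v, (q v * g v true + (1 - q v) * g v false) := by
  have h := Finset.prod_univ_sum (fun _ : V => (Finset.univ : Finset Bool))
    (fun v b => (if b then q v else 1 - q v) * g v b)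
  simp only [Fintype.piFinset_univ, Fintype.sum_bool] at h
  simp only [bernoulliExp, ← Finset.prod_mul_distrib]
  rw [← h]
  simp

theorem bernoulliExp_prod (S : Finset V) (g : V → Bool → ℝ) :
    bernoulliExp q (fun z => ∏ v ∈ S, g v (z v)) =
      ∏ v ∈ S, (q v * g v true + (1 - q v) * g v false) := by
  have h := bernoulliExp_prod_univ q (fun v b => if v ∈ S then g v b else 1)
  have e1 : ∀ z : V → Bool, ∏ v, (if v ∈ S then g v (z v) else 1) = ∏ v ∈ S, g v (z v) := by
    intro z
    rw [Finset.prod_ite_mem, Finset.univ_inter]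
  simp only [e1] at h
  rw [h, ← Finset.univ_inter S, ← Finset.prod_ite_mem, Finset.univ_inter]
  refine Finset.prod_congr rfl fun v _ => ?_
  split_ifs <;> ring

theorem bernoulliExp_const (a : ℝ) : bernoulliExp q (fun _ => a) = a := by
  have h := bernoulliExp_prod q ∅ (fun _ _ => 1)
  simp only [Finset.prod_empty] at h
  simp only [bernoulliExp, mul_one] at h ⊢
  rw [← Finset.sum_mul, h, one_mul]

theorem bernoulliExp_sum {ι : Type*} (s : Finset ι) (g : ι → (V → Bool) → ℝ) :
    bernoulliExp q (fun z => ∑ i ∈ s, g i z) = ∑ i ∈ s, bernoulliExp q (g i) := by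
  simp only [bernoulliExp, Finset.mul_sum]
  exact Finset.sum_comm

theorem bernoulliExp_const_mul (a : ℝ) (g : (V → Bool) → ℝ) :
    bernoulliExp q (fun z => a * g z) = a * bernoulliExp q g := by
  simp only [bernoulliExp, Finset.mul_sum]
  exact Finset.sum_congr rfl fun _ _ => by ring

theorem bernoulliExp_add (g h : (V → Bool) → ℝ) :
    bernoulliExp q (fun z => g z + h z) = bernoulliExp q g + bernoulliExp q h := by
  simp only [bernoulliExp, mul_add, Finset.sum_add_distrib]

theorem bernoulliExp_mono (hq0 : ∀ v, 0 ≤ q v) (hq1 : ∀ v, q v ≤ 1) {g h : (V → Bool) → ℝ}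
    (hgh : ∀ z, g z ≤ h z) : bernoulliExp q g ≤ bernoulliExp q h := by
  refine Finset.sum_le_sum fun z _ => mul_le_mul_of_nonneg_left (hgh z) ?_
  refine Finset.prod_nonneg fun v _ => ?_
  split_ifs
  · exact hq0 v
  · exact sub_nonneg.2 (hq1 v)

theorem exists_le_bernoulliExp (hq0 : ∀ v, 0 ≤ q v) (hq1 : ∀ v, q v ≤ 1)
    (g : (V → Bool) → ℝ) : ∃ z, g z ≤ bernoulliExp q g := by
  obtain ⟨z, -, hz⟩ := Finset.exists_min_image Finset.univ g Finset.univ_nonempty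
  refine ⟨z, ?_⟩
  rw [← bernoulliExp_const q (g z)]
  exact bernoulliExp_mono q hq0 hq1 fun z' => hz z' (Finset.mem_univ _)

theorem bernoulliExp_coord (x : V) (g : Bool → ℝ) :
    bernoulliExp q (fun z => g (z x)) = q x * g true + (1 - q x) * g false := by
  simpa using bernoulliExp_prod q {x} (fun _ => g)

theorem bernoulliExp_coord_mul {x y : V} (hxy : x ≠ y) (g h : Bool → ℝ) :
    bernoulliExp q (fun z => g (z x) * h (z y)) =
      (q x * g true + (1 - q x) * g false) * (q y * h true + (1 - q y) * h false) := by
  have := bernoulliExp_prod q {x, y} (fun v b => if v = x then g b else h b)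
  simpa [Finset.prod_pair hxy, hxy.symm] using this

theorem bernoulliExp_coord_mul_mul {x y t : V} (hxy : x ≠ y) (hxt : x ≠ t) (hyt : y ≠ t)
    (g h k : Bool → ℝ) :
    bernoulliExp q (fun z => g (z x) * (h (z y) * k (z t))) =
      (q x * g true + (1 - q x) * g false) * ((q y * h true + (1 - q y) * h false) *
        (q t * k true + (1 - q t) * k false)) := by
  have := bernoulliExp_prod q {x, y, t}
    (fun v b => if v = x then g b else if v = y then h b else k b)
  rw [Finset.prod_insert (by simp [hxy, hxt]), Finset.prod_pair hyt] at this
  simp only [Finset.prod_insert (show x ∉ ({y, t} : Finset V) by simp [hxy, hxt]),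
    Finset.prod_pair hyt] at this
  simpa [hxy.symm, hxt.symm, hyt.symm] using this

end BernoulliExp

/-! ### Random subsets and random cuts -/

/-- A random subset of `U`, containing each `x` independently with probability `q x`, has a good
outcome for a sum of vertex costs and squared deviations of weighted degrees. -/
theorem exists_subset_sum_deviation_le {V : Type*} [Fintype V] [DecidableEq V] (q : V → ℝ)
    (hq0 : ∀ v, 0 ≤ q v) (hq1 : ∀ v, q v ≤ 1) (U : Finset V) (c : V → ℝ) (K : ℝ)
    (a : V → V → ℝ) (ha : ∀ x, a x x = 0) :
    ∃ R ⊆ U, ∑ x ∈ R, (c x + K * (∑ y ∈ R, a x y - ∑ y ∈ U, a x y * q y) ^ 2) ≤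
      ∑ x ∈ U, q x * (c x + K * ∑ y ∈ U, a x y ^ 2 * (q y * (1 - q y))) := by
  set i : Bool → ℝ := fun b => if b then 1 else 0 with hi
  obtain ⟨z, hz⟩ := exists_le_bernoulliExp q hq0 hq1 (fun z => ∑ x ∈ U,
    i (z x) * (c x + K * (∑ y ∈ U, a x y * (i (z y) - q y)) ^ 2))
  refine ⟨U.filter fun v => z v = true, Finset.filter_subset _ _, ?_⟩
  -- Distinct centred coordinates are uncorrelated, so only variances survive. Since `a x x = 0`,
  -- the event that `x` is kept is independent of the coordinates that matter.
  have key : ∀ x ∈ U, ∀ y ∈ U, ∀ t ∈ U, bernoulliExp q (fun z => a x y * a x t *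
      (i (z x) * ((i (z y) - q y) * (i (z t) - q t)))) =
      if y = t then q x * (a x y ^ 2 * (q y * (1 - q y))) else 0 := by
    intro x _ y _ t _
    rw [bernoulliExp_const_mul]
    by_cases hxy : x = y
    · subst hxy; simp [ha]
    by_cases hxt : x = t
    · subst hxt; simp [ha, Ne.symm hxy]
    split_ifs with hyt
    · subst hyt
      have := bernoulliExp_coord_mul q hxy i (fun b => (i b - q y) * (i b - q y))
      rw [this]; simp [hi]; ring
    · have := bernoulliExp_coord_mul_mul q hxy hxt hyt i (fun b => i b - q y) (fun b => i b - q t)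
      rw [this]; simp [hi]; right; right; left; ring
  have e2 : bernoulliExp q (fun z => ∑ x ∈ U,
      i (z x) * (c x + K * (∑ y ∈ U, a x y * (i (z y) - q y)) ^ 2)) =
      ∑ x ∈ U, q x * (c x + K * ∑ y ∈ U, a x y ^ 2 * (q y * (1 - q y))) := by
    rw [bernoulliExp_sum]
    refine Finset.sum_congr rfl fun x hx => ?_
    have : ∀ z : V → Bool, i (z x) * (c x + K * (∑ y ∈ U, a x y * (i (z y) - q y)) ^ 2) =
        c x * i (z x) + K * ∑ y ∈ U, ∑ t ∈ U, a x y * a x t *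
          (i (z x) * ((i (z y) - q y) * (i (z t) - q t))) := by
      intro z
      have : (∑ y ∈ U, a x y * (i (z y) - q y)) ^ 2 = ∑ y ∈ U, ∑ t ∈ U,
          a x y * a x t * ((i (z y) - q y) * (i (z t) - q t)) := by
        rw [sq, Finset.sum_mul_sum]
        exact Finset.sum_congr rfl fun _ _ => Finset.sum_congr rfl fun _ _ => by ring
      rw [this, mul_add, mul_comm (i (z x)) (c x), mul_left_comm (i (z x)) K]
      simp only [Finset.mul_sum]
      congr 1
      exact Finset.sum_congr rfl fun _ _ => Finset.sum_congr rfl fun _ _ => by ring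
    simp only [this]
    rw [bernoulliExp_add, bernoulliExp_const_mul, bernoulliExp_const_mul, bernoulliExp_coord,
      bernoulliExp_sum]
    have : ∀ y ∈ U, bernoulliExp q (fun z => ∑ t ∈ U, a x y * a x t *
          (i (z x) * ((i (z y) - q y) * (i (z t) - q t)))) =
          q x * (a x y ^ 2 * (q y * (1 - q y))) := by
      intro y hy
      rw [bernoulliExp_sum, Finset.sum_congr rfl fun t ht => key x hx y hy t ht]
      simp [hy]
    rw [Finset.sum_congr rfl this, ← Finset.mul_sum]
    simp [hi]; ring
  rw [e2] at hz
  refine le_trans (le_of_eq ?_) hz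
  rw [Finset.sum_filter]
  refine Finset.sum_congr rfl fun x _ => ?_
  by_cases hzx : z x = true
  · have : ∑ y ∈ U with z y = true, a x y - ∑ y ∈ U, a x y * q y =
        ∑ y ∈ U, a x y * (i (z y) - q y) := by
      rw [Finset.sum_filter, ← Finset.sum_sub_distrib]
      refine Finset.sum_congr rfl fun y _ => ?_
      by_cases hzy : z y = true <;> simp [hi, hzy]; ring
    simp [hi, hzx] at this ⊢
    left; rw [this]
  · simp [hi, hzx]

/-- Every weighting has a cut carrying at least half of the total weight. -/
theorem exists_cut {V : Type*} [Fintype V] [DecidableEq V] (w : V → V → ℝ)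
    (h0 : ∀ x, w x x = 0) :
    ∃ z : V → Bool, (∑ x, ∑ y, w x y) / 2 ≤ ∑ x, ∑ y, if z x = z y then 0 else w x y := by
  -- Fair coins separate each pair with probability 1/2. Weights are negated because averaging
  -- supplies an outcome below the mean.
  obtain ⟨z, hz⟩ := exists_le_bernoulliExp (fun _ : V => (1 / 2 : ℝ)) (fun _ => by norm_num)
    (fun _ => by norm_num) (fun z => ∑ x, ∑ y, (-w x y) * (if z x = z y then 0 else 1))
  refine ⟨z, ?_⟩
  have key : ∀ x y, bernoulliExp (fun _ : V => (1 / 2 : ℝ))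
      (fun z => (-w x y) * (if z x = z y then 0 else 1)) = - (w x y / 2) := by
    intro x y
    by_cases hxy : x = y
    · subst hxy; simp [h0, bernoulliExp_const]
    rw [bernoulliExp_const_mul]
    have e : ∀ z : V → Bool, (if z x = z y then (0 : ℝ) else 1) =
        (if z x then 1 else 0) * (if z y then 0 else 1) +
          (if z x then 0 else 1) * (if z y then 1 else 0) := by
      intro z; cases z x <;> cases z y <;> simp
    simp only [e]
    rw [bernoulliExp_add, bernoulliExp_coord_mul _ hxy (fun b => if b then 1 else 0)
      (fun b => if b then 0 else 1), bernoulliExp_coord_mul _ hxy (fun b => if b then 0 else 1)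
      (fun b => if b then 1 else 0)]
    norm_num; ring
  rw [bernoulliExp_sum] at hz
  simp only [bernoulliExp_sum, key] at hz
  have e : ∀ x y, -w x y * (if z x = z y then 0 else 1) = -(if z x = z y then 0 else w x y) := by
    intro x y; split_ifs <;> simp
  simp only [e, Finset.sum_neg_distrib, ← Finset.sum_div] at hz
  linarith

/-! ### Edge weightings, trimming and one regularization step -/

/-- The weighted degree of `x` into `U`. -/
def weightedDegree {V : Type*} (w : V → V → ℝ) (U : Finset V) (x : V) : ℝ := ∑ y ∈ U, w x y

/-- A symmetric weight function with values in `[0, L]`, supported on the relation `r`. -/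
structure IsEdgeWeighting {V : Type*} (r : V → V → Prop) (w : V → V → ℝ) (L : ℝ) : Prop where
  symm : ∀ x y, w x y = w y x
  nonneg : ∀ x y, 0 ≤ w x y
  le : ∀ x y, w x y ≤ L
  supp : ∀ x y, w x y ≠ 0 → r x y

/-- Weights can be decreased so that all degrees are at most `D`, at a mean-square cost controlled
by the deviations of the degrees from targets `m x ≤ D`. -/
theorem exists_trim {V : Type*} (R : Finset V) (v : V → V → ℝ) (hs : ∀ x y, v x y = v y x)
    (hv : ∀ x y, 0 ≤ v x y) {D : ℝ} (hD : 0 < D) (m : V → ℝ) (hm : ∀ x ∈ R, m x ≤ D) :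
    ∃ (w : V → V → ℝ) (h : V → ℝ), (∀ x y, w x y = w y x) ∧ (∀ x y, 0 ≤ w x y) ∧
      (∀ x y, w x y ≤ v x y) ∧ (∀ x ∈ R, weightedDegree w R x ≤ D) ∧ (∀ x, 0 ≤ h x) ∧
      (∀ x ∈ R, D - weightedDegree w R x ≤ D - m x + h x) ∧
      ∑ x ∈ R, h x ^ 2 ≤ 4 * ∑ x ∈ R, (weightedDegree v R x - m x) ^ 2 := by
  set d := weightedDegree v R with hd
  have hd0 : ∀ x, 0 ≤ d x := fun x => Finset.sum_nonneg fun y _ => hv x y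
  -- Each overloaded vertex asks its edges to shrink by `t x`; an edge obeys both ends.
  set t : V → ℝ := fun x => D / max (d x) D with ht
  have hmax : ∀ x, 0 < max (d x) D := fun x => lt_max_of_lt_right hD
  have ht0 : ∀ x, 0 ≤ t x := fun x => (div_pos hD (hmax x)).le
  have ht1 : ∀ x, t x ≤ 1 := fun x => (div_le_one (hmax x)).2 (le_max_right _ _)
  have htd : ∀ x, t x * d x ≤ D := fun x => by
    rw [ht]; simp only []
    rw [div_mul_eq_mul_div, div_le_iff₀ (hmax x)]
    exact mul_le_mul_of_nonneg_left (le_max_left _ _) hD.le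
  -- Collateral loss at `x`, caused by overloaded neighbours.
  set e : V → ℝ := fun x => ∑ y ∈ R, t x * v x y * (1 - t y) with he
  have he0 : ∀ x, 0 ≤ e x := fun x => Finset.sum_nonneg fun y _ =>
    mul_nonneg (mul_nonneg (ht0 x) (hv x y)) (sub_nonneg.2 (ht1 y))
  have hdeg : ∀ x, weightedDegree (fun x y => t x * t y * v x y) R x = t x * d x - e x := by
    intro x
    simp only [weightedDegree, he, hd, Finset.mul_sum, ← Finset.sum_sub_distrib]
    exact Finset.sum_congr rfl fun _ _ => by ring
  refine ⟨fun x y => t x * t y * v x y, fun x => |d x - m x| + e x, ?_, ?_, ?_, ?_, ?_, ?_, ?_⟩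
  · intro x y; simp only [hs x y]; ring
  · intro x y; exact mul_nonneg (mul_nonneg (ht0 x) (ht0 y)) (hv x y)
  · intro x y
    exact mul_le_of_le_one_left (hv x y) (mul_le_one₀ (ht1 x) (ht0 y) (ht1 y))
  · intro x _
    rw [hdeg]; linarith [htd x, he0 x]
  · intro x; exact add_nonneg (abs_nonneg _) (he0 x)
  · intro x hx
    rw [hdeg]
    have : min (d x) D ≤ t x * d x := by
      simp only [ht]
      rcases le_total (d x) D with h | h
      · rw [max_eq_right h, div_self hD.ne', one_mul]; exact min_le_left _ _
      · rw [max_eq_left h, div_mul_cancel₀ _ (hD.trans_le h).ne']; exact min_le_right _ _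
    have h2 : m x - |d x - m x| ≤ min (d x) D :=
      le_min (by linarith [neg_abs_le (d x - m x)]) (by linarith [hm x hx, abs_nonneg (d x - m x)])
    linarith
  · have hsum : ∑ x ∈ R, e x ^ 2 ≤ ∑ x ∈ R, (d x - m x) ^ 2 := by
      have h1 : ∀ x ∈ R, e x ^ 2 ≤ ∑ y ∈ R, D * (v x y * (1 - t y) ^ 2) := by
        intro x _
        have cs := Finset.sum_sq_le_sum_mul_sum_of_sq_le_mul R
          (r := fun y => t x * v x y * (1 - t y)) (f := fun y => t x * v x y)
          (g := fun y => t x * v x y * (1 - t y) ^ 2)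
          (fun y _ => mul_nonneg (ht0 x) (hv x y))
          (fun y _ => mul_nonneg (mul_nonneg (ht0 x) (hv x y)) (sq_nonneg _))
          (fun y _ => le_of_eq (by ring))
        refine cs.trans ?_
        have a1 : ∑ y ∈ R, t x * v x y ≤ D := by rw [← Finset.mul_sum]; exact htd x
        have a2 : ∑ y ∈ R, t x * v x y * (1 - t y) ^ 2 ≤ ∑ y ∈ R, v x y * (1 - t y) ^ 2 :=
          Finset.sum_le_sum fun y _ => mul_le_mul_of_nonneg_right
            (mul_le_of_le_one_left (hv x y) (ht1 x)) (sq_nonneg _)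
        rw [← Finset.mul_sum R (fun y => v x y * (1 - t y) ^ 2) D]
        exact mul_le_mul a1 a2 (Finset.sum_nonneg fun y _ =>
          mul_nonneg (mul_nonneg (ht0 x) (hv x y)) (sq_nonneg _)) hD.le
      refine (Finset.sum_le_sum h1).trans ?_
      rw [Finset.sum_comm]
      refine Finset.sum_le_sum fun y hy => ?_
      have : ∑ x ∈ R, D * (v x y * (1 - t y) ^ 2) = D * (d y * (1 - t y) ^ 2) := by
        rw [← Finset.mul_sum, ← Finset.sum_mul]
        simp only [hd, weightedDegree, hs y]
      rw [this]
      rcases le_total (d y) D with h | h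
      · have : t y = 1 := by simp only [ht]; rw [max_eq_right h, div_self hD.ne']
        rw [this]; simp; positivity
      · have hdy : 0 < d y := hD.trans_le h
        have h1t : d y * (1 - t y) = d y - D := by
          simp only [ht]; rw [max_eq_left h]; field_simp
        have h2t : D * (1 - t y) ≤ d y - D := by
          rw [← h1t]; exact mul_le_mul_of_nonneg_right h (sub_nonneg.2 (ht1 y))
        calc D * (d y * (1 - t y) ^ 2) = (D * (1 - t y)) * (d y * (1 - t y)) := by ring
          _ ≤ (d y - D) * (d y - D) := by
            rw [h1t]; exact mul_le_mul_of_nonneg_right h2t (sub_nonneg.2 h)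
          _ ≤ (d y - m y) ^ 2 := by
            rw [← sq]; exact pow_le_pow_left₀ (sub_nonneg.2 h) (by linarith [hm y hy]) 2
    have : ∀ x ∈ R, (|d x - m x| + e x) ^ 2 ≤ 2 * (d x - m x) ^ 2 + 2 * e x ^ 2 := by
      intro x _
      rw [← sq_abs (d x - m x)]
      nlinarith [sq_nonneg (|d x - m x| - e x)]
    refine (Finset.sum_le_sum this).trans ?_
    rw [Finset.sum_add_distrib, ← Finset.mul_sum, ← Finset.mul_sum]
    linarith

/-- One regularization step: keep each `x` with probability `q x`, the larger of `κ` and the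
relative degree of `x`, divide the surviving weights by the retention probabilities, and trim. -/
theorem exists_regularization_step {V : Type*} [Fintype V] [DecidableEq V] {r : V → V → Prop}
    (hr : ∀ x, ¬ r x x) {w : V → V → ℝ} {L : ℝ} (hw : IsEdgeWeighting r w L) {U : Finset V}
    {D κ ε τ M B : ℝ} (hD : 0 < D) (hκ : 0 < κ) (hκ1 : κ ≤ 1) (hε : 0 < ε) (hτ : 0 < τ)
    (hM : 0 < M) (hL : 0 ≤ L)
    (hdeg : ∀ x ∈ U, weightedDegree w U x ≤ D)
    (q : V → ℝ) (hq : ∀ x ∈ U, q x = max κ (weightedDegree w U x / D))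
    (hB : ∑ x ∈ U, q x * ((1 + ε) * (D - weightedDegree w U x / q x) ^ 2 / D +
      (D - weightedDegree w U x / q x) / M + τ / (2 * M) - B) +
      4 * ((1 + 1 / ε) / D + 1 / (2 * τ * M)) * (L / κ ^ 2 *
        ∑ x ∈ U, (D - weightedDegree w U x)) < 0) :
    ∃ (U' : Finset V) (w' : V → V → ℝ), U'.Nonempty ∧ IsEdgeWeighting r w' (L / κ ^ 2) ∧
      (∀ x ∈ U', weightedDegree w' U' x ≤ D) ∧
      ∑ x ∈ U', ((D - weightedDegree w' U' x) ^ 2 / D + (D - weightedDegree w' U' x) / M) ≤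
        B * U'.card := by
  -- The cap at 1 makes this a probability off `U` too; on `U` it equals `q`.
  set p : V → ℝ := fun x => max κ (min 1 (weightedDegree w U x / D)) with hp
  have hpq : ∀ x ∈ U, p x = q x := fun x hx => by
    rw [hq x hx, hp]; simp only []
    rw [min_eq_right ((div_le_one hD).2 (hdeg x hx))]
  have hpκ : ∀ x, κ ≤ p x := fun x => le_max_left _ _
  have hp0 : ∀ x, 0 < p x := fun x => hκ.trans_le (hpκ x)
  have hp1 : ∀ x, p x ≤ 1 := fun x => max_le hκ1 (min_le_left _ _)
  set d := weightedDegree w U with hd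
  have hpd : ∀ x ∈ U, d x / D ≤ p x := fun x hx => by
    rw [hpq x hx, hq x hx]; exact le_max_right _ _
  set v : V → V → ℝ := fun x y => w x y / (p x * p y) with hv
  have hv0 : ∀ x y, 0 ≤ v x y := fun x y =>
    div_nonneg (hw.nonneg x y) (mul_pos (hp0 x) (hp0 y)).le
  have hvs : ∀ x y, v x y = v y x := fun x y => by
    simp only [hv, hw.symm x y, mul_comm]
  have hvL : ∀ x y, v x y ≤ L / κ ^ 2 := fun x y => by
    refine div_le_div₀ hL (hw.le x y) (by positivity) ?_
    rw [sq]; exact mul_le_mul (hpκ x) (hpκ y) hκ.le (hp0 x).le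
  have hw0 : ∀ x, w x x = 0 := fun x => by
    by_contra h; exact hr x (hw.supp x x h)
  -- The expected degree of a kept vertex: exactly `D` unless the floor `κ` is active.
  have hmean : ∀ x, ∑ y ∈ U, v x y * p y = d x / p x := fun x => by
    simp only [hd, weightedDegree, Finset.sum_div, hv]
    refine Finset.sum_congr rfl fun y _ => ?_
    have := (hp0 y).ne'; have := (hp0 x).ne'
    field_simp
  set K := 4 * ((1 + 1 / ε) / D + 1 / (2 * τ * M)) with hK
  have hK0 : 0 ≤ K := by positivity
  -- The cost of `x` apart from fluctuations. Subtracting `B` per kept vertex turns a negative total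
  -- into the desired average bound, and also forces the kept set to be nonempty.
  set c : V → ℝ := fun x => (1 + ε) * (D - d x / p x) ^ 2 / D +
      (D - d x / p x) / M + τ / (2 * M) - B with hc
  obtain ⟨R, hRU, hR⟩ := exists_subset_sum_deviation_le p (fun x => (hp0 x).le) hp1 U c K v
    (fun x => by simp [hv, hw0])
  -- One factor `v` is bounded by `L / κ ^ 2`; the rest sums to `d y * (1 - p y) ≤ D - d y`, as `p y
  -- ≥ d y / D`. Thus the variance is controlled by the current defect.
  have hvar : ∑ x ∈ U, p x * ∑ y ∈ U, v x y ^ 2 * (p y * (1 - p y)) ≤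
      L / κ ^ 2 * ∑ x ∈ U, (D - d x) := by
    have h1 : ∀ x ∈ U, p x * ∑ y ∈ U, v x y ^ 2 * (p y * (1 - p y)) ≤
        ∑ y ∈ U, L / κ ^ 2 * (w x y * (1 - p y)) := by
      intro x _
      rw [Finset.mul_sum]
      refine Finset.sum_le_sum fun y _ => ?_
      have e : p x * (v x y ^ 2 * (p y * (1 - p y))) = v x y * (w x y * (1 - p y)) := by
        have := (hp0 y).ne'; have := (hp0 x).ne'
        simp only [hv]; field_simp
      rw [e]
      exact mul_le_mul_of_nonneg_right (hvL x y)
        (mul_nonneg (hw.nonneg x y) (sub_nonneg.2 (hp1 y)))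
    refine (Finset.sum_le_sum h1).trans ?_
    rw [Finset.sum_comm, Finset.mul_sum]
    refine Finset.sum_le_sum fun y hy => ?_
    rw [← Finset.mul_sum]
    refine mul_le_mul_of_nonneg_left ?_ (by positivity)
    rw [← Finset.sum_mul]
    have e : ∑ x ∈ U, w x y = d y := by
      simp only [hd, weightedDegree, hw.symm y]
    rw [e]
    have h2 := hpd y hy
    rw [div_le_iff₀ hD] at h2
    calc d y * (1 - p y) ≤ D * (1 - p y) :=
          mul_le_mul_of_nonneg_right (hdeg y hy) (sub_nonneg.2 (hp1 y))
      _ ≤ D - d y := by linarith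
  have hneg : ∑ x ∈ R, (c x + K * (weightedDegree v R x - d x / p x) ^ 2) < 0 := by
    simp only [hmean] at hR
    refine lt_of_le_of_lt (hR.trans ?_) hB
    have e : ∑ x ∈ U, p x * (c x + K * ∑ y ∈ U, v x y ^ 2 * (p y * (1 - p y))) =
        ∑ x ∈ U, p x * c x + K * ∑ x ∈ U, p x * ∑ y ∈ U, v x y ^ 2 * (p y * (1 - p y)) := by
      rw [Finset.mul_sum, ← Finset.sum_add_distrib]
      exact Finset.sum_congr rfl fun _ _ => by ring
    rw [e]
    refine add_le_add (le_of_eq (Finset.sum_congr rfl fun x hx => ?_))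
      (mul_le_mul_of_nonneg_left hvar hK0)
    simp only [hc, hpq x hx]
  have hmD : ∀ x ∈ R, d x / p x ≤ D := fun x hx => by
    have := hpd x (hRU hx)
    rw [div_le_iff₀ hD] at this
    rw [div_le_iff₀ (hp0 x)]; linarith
  obtain ⟨w', h, ws, w0, wv, wD, h0, hf, hh⟩ := exists_trim R v hvs hv0 hD (fun x => d x / p x) hmD
  refine ⟨R, w', ?_, ⟨ws, w0, fun x y => (wv x y).trans (hvL x y), fun x y hxy => ?_⟩, wD, ?_⟩
  · rw [Finset.nonempty_iff_ne_empty]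
    rintro rfl
    simp at hneg
  · refine hw.supp x y fun h => hxy (le_antisymm ((wv x y).trans ?_) (w0 x y))
    simp [hv, h]
  -- Young's inequality, with parameter `ε` for the square and `τ` for the linear term, separates
  -- the mean defect `F` from the fluctuation `h`.
  · have pt : ∀ x ∈ R, (D - weightedDegree w' R x) ^ 2 / D + (D - weightedDegree w' R x) / M ≤
        (c x + B) + ((1 + 1 / ε) / D + 1 / (2 * τ * M)) * h x ^ 2 := by
      intro x hx
      have f0 : 0 ≤ D - weightedDegree w' R x := sub_nonneg.2 (wD x hx)
      set F := D - d x / p x with hF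
      have fb : 0 ≤ F := sub_nonneg.2 (hmD x hx)
      have hfx : D - weightedDegree w' R x ≤ F + h x := hf x hx
      have s1 : (D - weightedDegree w' R x) ^ 2 ≤ (1 + ε) * F ^ 2 + (1 + 1 / ε) * h x ^ 2 := by
        refine (pow_le_pow_left₀ f0 hfx 2).trans ?_
        have : (1 + ε) * F ^ 2 + (1 + 1 / ε) * h x ^ 2 - (F + h x) ^ 2 =
            (ε * F - h x) ^ 2 / ε := by field_simp; ring
        have : 0 ≤ (ε * F - h x) ^ 2 / ε := by positivity
        linarith
      have s2 : D - weightedDegree w' R x ≤ F + (τ / 2 + h x ^ 2 / (2 * τ)) := by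
        have : τ / 2 + h x ^ 2 / (2 * τ) - h x = (τ - h x) ^ 2 / (2 * τ) := by field_simp; ring
        have : 0 ≤ (τ - h x) ^ 2 / (2 * τ) := by positivity
        linarith
      have s3 := div_le_div_of_nonneg_right s1 hD.le
      have s4 := div_le_div_of_nonneg_right s2 hM.le
      refine (add_le_add s3 s4).trans (le_of_eq ?_)
      simp only [hc, ← hF]
      field_simp
      ring
    refine (Finset.sum_le_sum pt).trans ?_
    rw [Finset.sum_add_distrib, Finset.sum_add_distrib, ← Finset.mul_sum, Finset.sum_const,
      nsmul_eq_mul]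
    rw [Finset.sum_add_distrib, ← Finset.mul_sum] at hneg
    have hk : ((1 + 1 / ε) / D + 1 / (2 * τ * M)) * ∑ x ∈ R, h x ^ 2 ≤
        K * ∑ x ∈ R, (weightedDegree v R x - d x / p x) ^ 2 := by
      rw [hK]
      refine (mul_le_mul_of_nonneg_left hh (by positivity)).trans (le_of_eq (by ring))
    linarith

/-! ### Iteration down the scales -/

/-- The induction invariant: a nonempty vertex set with an edge weighting bounded by `L`, degrees
at most `D`, and average degree defect controlled at scale `u ^ 2`. -/
def HasNearRegularWeighting {V : Type*} (r : V → V → Prop) (D L B u : ℝ) : Prop :=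
  ∃ (U : Finset V) (w : V → V → ℝ), U.Nonempty ∧ IsEdgeWeighting r w L ∧
    (∀ x ∈ U, weightedDegree w U x ≤ D) ∧
    ∑ x ∈ U, ((D - weightedDegree w U x) ^ 2 / D + (D - weightedDegree w U x) / u ^ 2) ≤
      B * U.card

theorem HasNearRegularWeighting.mono {V : Type*} {r : V → V → Prop} {D L B u L' B' : ℝ}
    (h : HasNearRegularWeighting r D L B u) (hL : L ≤ L') (hB : B ≤ B') :
    HasNearRegularWeighting r D L' B' u := by
  obtain ⟨U, w, hU, hw, hd, hs⟩ := h
  exact ⟨U, w, hU, ⟨hw.symm, hw.nonneg, fun x y => (hw.le x y).trans hL, hw.supp⟩, hd,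
    hs.trans (mul_le_mul_of_nonneg_right hB (Nat.cast_nonneg _))⟩

/-- The first regularization step, from degrees in `[κ D, D]` to mean-square defect `O(D)`. -/
theorem HasNearRegularWeighting.of_almostRegular {V : Type*} [Fintype V] [DecidableEq V]
    {r : V → V → Prop} (hr : ∀ x, ¬ r x x) {w : V → V → ℝ} (hw : IsEdgeWeighting r w 1)
    {U : Finset V} (hU : U.Nonempty) {D κ u : ℝ} (hD : 0 < D) (hκ : 0 < κ) (hκ1 : κ ≤ 1)
    (hu : 0 < u) (hDu : D ≤ 16 * u ^ 4)
    (hdeg : ∀ x ∈ U, weightedDegree w U x ≤ D) (hdeg' : ∀ x ∈ U, κ * D ≤ weightedDegree w U x) :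
    HasNearRegularWeighting r D (1 / κ ^ 2) (50 / κ ^ 3) u := by
  refine exists_regularization_step hr hw (ε := 1) (τ := u ^ 2)
    (M := u ^ 2) (B := 50 / κ ^ 3) hD hκ hκ1 one_pos (by positivity) (by positivity) zero_le_one
    hdeg (fun x => max κ (weightedDegree w U x / D)) (fun _ _ => rfl) ?_
  have hn : (0 : ℝ) < U.card := by exact_mod_cast hU.card_pos
  -- The floor is inactive here, so mean defects vanish and only the variance, at most `40 / κ ^ 2`
  -- per vertex, must be beaten by `κ * B = 50 / κ ^ 2`.
  have e1 : ∀ x ∈ U, max κ (weightedDegree w U x / D) *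
      ((1 + 1) * (D - weightedDegree w U x / max κ (weightedDegree w U x / D)) ^ 2 / D +
      (D - weightedDegree w U x / max κ (weightedDegree w U x / D)) / u ^ 2 +
      u ^ 2 / (2 * u ^ 2) - 50 / κ ^ 3) ≤ κ * (1 / 2 - 50 / κ ^ 3) := by
    intro x hx
    have hd : 0 < weightedDegree w U x := (mul_pos hκ hD).trans_le (hdeg' x hx)
    rw [max_eq_right ((le_div_iff₀ hD).2 (hdeg' x hx))]
    have : D - weightedDegree w U x / (weightedDegree w U x / D) = 0 := by field_simp; simp
    rw [this]
    have : u ^ 2 / (2 * u ^ 2) = 1 / 2 := by field_simp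
    rw [this]
    have h50 : 50 ≤ 50 / κ ^ 3 := by
      rw [le_div_iff₀ (by positivity)]
      nlinarith [pow_le_one₀ hκ.le hκ1 (n := 3)]
    have := (le_div_iff₀ hD).2 (hdeg' x hx)
    simp only [ne_eq, OfNat.ofNat_ne_zero, not_false_eq_true, zero_pow, mul_zero, zero_div,
      zero_add]
    exact mul_le_mul_of_nonpos_right this (by linarith)
  have e2 : ∑ x ∈ U, (D - weightedDegree w U x) ≤ U.card * D := by
    rw [← nsmul_eq_mul]
    refine Finset.sum_le_card_nsmul _ _ _ fun x hx => ?_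
    have := hdeg' x hx
    have := mul_pos hκ hD
    linarith
  have e3 : 4 * ((1 + 1 / 1) / D + 1 / (2 * u ^ 2 * u ^ 2)) ≤ 40 / D := by
    have : 1 / (2 * u ^ 2 * u ^ 2) ≤ 8 / D := by
      rw [div_le_div_iff₀ (by positivity) hD]; nlinarith
    have e : (40 : ℝ) / D = 4 * (2 / D + 8 / D) := by ring
    rw [e]
    norm_num at this ⊢
    exact this
  have e4 : 4 * ((1 + 1 / 1) / D + 1 / (2 * u ^ 2 * u ^ 2)) * (1 / κ ^ 2 *
      ∑ x ∈ U, (D - weightedDegree w U x)) ≤ 40 / D * (1 / κ ^ 2 * (U.card * D)) := by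
    refine mul_le_mul e3 (mul_le_mul_of_nonneg_left e2 (by positivity)) ?_ (by positivity)
    exact mul_nonneg (by positivity) (Finset.sum_nonneg fun x hx => sub_nonneg.2 (hdeg x hx))
  have e5 := Finset.sum_le_sum e1
  rw [Finset.sum_const, nsmul_eq_mul] at e5
  refine lt_of_le_of_lt (add_le_add e5 e4) ?_
  have : (U.card : ℝ) * (κ * (1 / 2 - 50 / κ ^ 3)) + 40 / D * (1 / κ ^ 2 * (U.card * D)) =
      U.card * (κ / 2 - 10 / κ ^ 2) := by
    field_simp; ring
  rw [this]
  refine mul_neg_of_pos_of_neg hn ?_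
  have : 10 ≤ 10 / κ ^ 2 := by
    rw [le_div_iff₀ (by positivity)]
    nlinarith [pow_le_one₀ hκ.le hκ1 (n := 2)]
  linarith

/-- Later regularization steps: the scale `u` of the defect is halved, at the price of factors
`1 + O(1 / u)` in the bounds. -/
theorem HasNearRegularWeighting.half {V : Type*} [Fintype V] [DecidableEq V]
    {r : V → V → Prop} (hr : ∀ x, ¬ r x x) {D L B Λ u : ℝ} (hΛ : 1 ≤ Λ) (hL : 0 ≤ L)
    (hLΛ : L ≤ 2 * Λ) (hB : 1 ≤ B) (hu : 200 * Λ ≤ u) (huD : u ^ 4 ≤ D)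
    (h : HasNearRegularWeighting r D L B u) :
    HasNearRegularWeighting r D (L * (1 + 4 / u)) (B * (1 + 100 * Λ / u)) (u / 2) := by
  obtain ⟨U, w, hU, hw, hdeg, hs⟩ := h
  have hu200 : 200 ≤ u := by linarith
  have hu0 : 0 < u := by linarith
  have hD : 0 < D := lt_of_lt_of_le (by positivity) huD
  have hn : (0 : ℝ) < U.card := by exact_mod_cast hU.card_pos
  -- A floor this close to 1 keeps weight growth to `1 + O(1 / u)`.
  set κ := 1 - 1 / u with hκ
  have hiu : 1 / u ≤ 1 / 200 := one_div_le_one_div_of_le (by norm_num) hu200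
  have hiu0 : 0 < 1 / u := by positivity
  have hκ0 : 0 < κ := by rw [hκ]; linarith
  have hκ1 : κ ≤ 1 := by rw [hκ]; linarith
  have hκL : 1 / κ ^ 2 ≤ 1 + 4 / u := by
    rw [div_le_iff₀ (by positivity), hκ, show 4 / u = 4 * (1 / u) by ring]
    set s := 1 / u
    nlinarith [mul_nonneg hiu0.le (sub_nonneg.2 hiu), mul_nonneg (sq_nonneg s) hiu0.le]
  have hLκ : L / κ ^ 2 ≤ L * (1 + 4 / u) := by
    rw [div_eq_mul_one_div]; exact mul_le_mul_of_nonneg_left hκL hL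
  set B' := B * (1 + 100 * Λ / u) with hB'
  have hB'0 : 0 < B' := by positivity
  refine HasNearRegularWeighting.mono (L := L / κ ^ 2) (exists_regularization_step hr hw
    (ε := 1 / u) (τ := u) (M := (u / 2) ^ 2) (B := B') hD hκ0 hκ1 (by positivity) (by positivity)
    (by positivity) hL hdeg (fun x => max κ (weightedDegree w U x / D)) (fun _ _ => rfl) ?_)
    hLκ le_rfl
  set f : V → ℝ := fun x => D - weightedDegree w U x with hf
  have hf0 : ∀ x ∈ U, 0 ≤ f x := fun x hx => sub_nonneg.2 (hdeg x hx)
  have e1 : ∀ x ∈ U, max κ (weightedDegree w U x / D) *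
      ((1 + 1 / u) * (D - weightedDegree w U x / max κ (weightedDegree w U x / D)) ^ 2 / D +
      (D - weightedDegree w U x / max κ (weightedDegree w U x / D)) / (u / 2) ^ 2 +
      u / (2 * (u / 2) ^ 2) - B') ≤ (1 + 2 / u) * (f x ^ 2 / D) + (2 / u - κ * B') := by
    intro x hx
    set d := weightedDegree w U x with hd
    set q := max κ (d / D) with hq
    have hqκ : κ ≤ q := le_max_left _ _
    have hq0 : 0 < q := hκ0.trans_le hqκ
    have hq1 : q ≤ 1 := max_le hκ1 ((div_le_one hD).2 (hdeg x hx))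
    have hdq : d ≤ D * q := by
      have : d / D ≤ q := le_max_right _ _
      rw [div_le_iff₀ hD] at this; linarith
    have hd0 : 0 ≤ d := Finset.sum_nonneg fun y _ => hw.nonneg x y
    have F0 : 0 ≤ D - d / q := by rw [sub_nonneg, div_le_iff₀ hq0]; exact hdq
    have Ff : D - d / q ≤ f x := by
      have : d ≤ d / q := by rw [le_div_iff₀ hq0]; nlinarith
      simp only [hf]; linarith
    have hfx := hf0 x hx
    have t1 : q * ((1 + 1 / u) * (D - d / q) ^ 2 / D) ≤ (1 + 1 / u) * (f x ^ 2 / D) := by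
      have : (D - d / q) ^ 2 ≤ f x ^ 2 := pow_le_pow_left₀ F0 Ff 2
      calc q * ((1 + 1 / u) * (D - d / q) ^ 2 / D) ≤ 1 * ((1 + 1 / u) * (D - d / q) ^ 2 / D) :=
            mul_le_mul_of_nonneg_right hq1 (by positivity)
        _ = (1 + 1 / u) * ((D - d / q) ^ 2 / D) := by ring
        _ ≤ _ := mul_le_mul_of_nonneg_left (div_le_div_of_nonneg_right this hD.le)
            (by positivity)
    have t2 : q * ((D - d / q) / (u / 2) ^ 2) ≤ 1 / u * (f x ^ 2 / D) := by
      -- A mean defect remains only below the floor, where the left side is `f x - D / u`. AM–GM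
      -- charges it to the quadratic part of the invariant, which is why that part is carried along.
      have : q * (D - d / q) ≤ u * f x ^ 2 / (4 * D) := by
        have e : q * (D - d / q) = q * D - d := by field_simp
        rw [e]
        rcases le_total (d / D) κ with h | h
        · have : q = κ := max_eq_left h
          rw [this, hκ, le_div_iff₀ (by positivity)]
          have e2 : u * f x ^ 2 - ((1 - 1 / u) * D - d) * (4 * D) = (u * f x - 2 * D) ^ 2 / u := by
            simp only [hf]; field_simp; ring
          have : 0 ≤ (u * f x - 2 * D) ^ 2 / u := by positivity
          linarith
        · have : q = d / D := max_eq_right h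
          rw [this, div_mul_cancel₀ _ hD.ne', sub_self]; positivity
      calc q * ((D - d / q) / (u / 2) ^ 2) = (q * (D - d / q)) / (u / 2) ^ 2 := by ring
        _ ≤ u * f x ^ 2 / (4 * D) / (u / 2) ^ 2 := div_le_div_of_nonneg_right this (by positivity)
        _ = 1 / u * (f x ^ 2 / D) := by field_simp; ring
    have t3 : q * (u / (2 * (u / 2) ^ 2)) ≤ 2 / u := by
      have e : u / (2 * (u / 2) ^ 2) = 2 / u := by field_simp
      rw [e]; exact mul_le_of_le_one_left (by positivity) hq1
    have t4 : κ * B' ≤ q * B' := mul_le_mul_of_nonneg_right hqκ hB'0.le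
    calc _ = q * ((1 + 1 / u) * (D - d / q) ^ 2 / D) + q * ((D - d / q) / (u / 2) ^ 2) +
          q * (u / (2 * (u / 2) ^ 2)) - q * B' := by ring
      _ ≤ (1 + 1 / u) * (f x ^ 2 / D) + 1 / u * (f x ^ 2 / D) + 2 / u - κ * B' := by linarith
      _ = _ := by ring
  have e5 := Finset.sum_le_sum e1
  rw [Finset.sum_add_distrib, ← Finset.mul_sum, Finset.sum_const, nsmul_eq_mul] at e5
  rw [Finset.sum_add_distrib, ← Finset.sum_div U _ (u ^ 2)] at hs
  have S1 : 0 ≤ ∑ x ∈ U, f x ^ 2 / D := Finset.sum_nonneg fun x _ => by positivity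
  have S2 : 0 ≤ ∑ x ∈ U, f x := Finset.sum_nonneg hf0
  have S1' : ∑ x ∈ U, f x ^ 2 / D ≤ B * U.card := by
    have : 0 ≤ (∑ x ∈ U, f x) / u ^ 2 := by positivity
    linarith
  have S2' : ∑ x ∈ U, f x ≤ B * U.card * u ^ 2 := by
    rw [← div_le_iff₀ (by positivity)]
    linarith
  -- Here `u ^ 4 ≤ D` enters: defects of order `u ^ 2` produce fluctuation cost only `O(1 / u)`.
  have K1 : 4 * ((1 + 1 / (1 / u)) / D + 1 / (2 * u * (u / 2) ^ 2)) * u ^ 2 ≤ 16 / u := by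
    have a1 : (1 + u) / D ≤ 2 / u ^ 3 := by
      rw [div_le_div_iff₀ hD (by positivity)]
      nlinarith [pow_pos hu0 3]
    have a2 : 1 / (2 * u * (u / 2) ^ 2) = 2 / u ^ 3 := by field_simp
    rw [one_div_one_div, a2]
    calc 4 * ((1 + u) / D + 2 / u ^ 3) * u ^ 2 ≤ 4 * (2 / u ^ 3 + 2 / u ^ 3) * u ^ 2 := by gcongr
      _ = 16 / u := by field_simp; norm_num
  have L3 : L / κ ^ 2 ≤ 3 * Λ := by
    refine hLκ.trans ?_
    have : 4 / u ≤ 1 / 50 := by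
      rw [show 4 / u = 4 * (1 / u) by ring]; linarith
    nlinarith
  have e4 : 4 * ((1 + 1 / (1 / u)) / D + 1 / (2 * u * (u / 2) ^ 2)) * (L / κ ^ 2 *
      ∑ x ∈ U, f x) ≤ 16 / u * (3 * Λ) * (B * U.card) := by
    set K := 4 * ((1 + 1 / (1 / u)) / D + 1 / (2 * u * (u / 2) ^ 2)) with hK
    have hK0 : 0 ≤ K := by positivity
    calc K * (L / κ ^ 2 * ∑ x ∈ U, f x) ≤ K * (3 * Λ * (B * U.card * u ^ 2)) := by gcongr
      _ = (K * u ^ 2) * (3 * Λ * (B * U.card)) := by ring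
      _ ≤ 16 / u * (3 * Λ * (B * U.card)) := by gcongr
      _ = _ := by ring
  have e6 : (1 + 2 / u) * ∑ x ∈ U, f x ^ 2 / D ≤ (1 + 2 / u) * (B * U.card) :=
    mul_le_mul_of_nonneg_left S1' (by positivity)
  have key : (1 + 2 / u) * (B * U.card) + U.card * (2 / u - κ * B') +
      16 / u * (3 * Λ) * (B * U.card) < 0 := by
    have e : (1 + 2 / u) * (B * U.card) + U.card * (2 / u - κ * B') +
      16 / u * (3 * Λ) * (B * U.card) = (1 / u) * U.card *
        (2 * B + 2 + B - 52 * (B * Λ) + B * (100 * Λ * (1 / u))) := by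
      simp only [hκ, hB']; field_simp; ring
    rw [e]
    refine mul_neg_of_pos_of_neg (mul_pos hiu0 hn) ?_
    have h1 : 100 * Λ * (1 / u) ≤ 1 / 2 := by
      rw [mul_one_div, div_le_iff₀ hu0]; linarith
    nlinarith [mul_le_mul_of_nonneg_left h1 (show 0 ≤ B by linarith),
      mul_le_mul_of_nonneg_left hΛ (show 0 ≤ B by linarith)]
  refine lt_of_le_of_lt (add_le_add e5 e4) ?_
  linarith

/-- Iterating the halving step down to a constant scale. -/
theorem HasNearRegularWeighting.iterate {V : Type*} [Fintype V] [DecidableEq V]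
    {r : V → V → Prop} (hr : ∀ x, ¬ r x x) {D B Λ u₀ : ℝ} (hΛ : 1 ≤ Λ) (hB : 1 ≤ B)
    (hu₀ : 200 * Λ ≤ u₀) (n : ℕ) (u : ℝ) (hu : u₀ ≤ u) (hun : (2 ^ n * u) ^ 4 ≤ D)
    (h : HasNearRegularWeighting r D Λ B (2 ^ n * u)) :
    HasNearRegularWeighting r D (Λ * (1 + 8 / u)) (B * (1 + 200 * Λ / u)) u := by
  have hu0 : 0 < u := by linarith
  induction n generalizing u with
  | zero =>
    rw [pow_zero, one_mul] at h
    refine h.mono ?_ ?_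
    · nlinarith [show 0 < 8 / u by positivity]
    · nlinarith [show 0 < 200 * Λ / u by positivity]
  | succ n ih =>
    -- The hypothesis is applied at `2 * u`, followed by one halving. The error bound at `2 * u` is
    -- half that at `u`, which leaves room for the new factor.
    have e : (2 : ℝ) ^ (n + 1) * u = 2 ^ n * (2 * u) := by ring
    rw [e] at h hun
    have h2 := ih (2 * u) (by linarith) hun h (by linarith)
    have h200 : 200 ≤ u := by linarith
    have hi : 1 / u ≤ 1 / 200 := one_div_le_one_div_of_le (by norm_num) h200
    have hi0 : 0 < 1 / u := by positivity
    have hΛi : Λ * (1 / u) ≤ 1 / 200 := by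
      rw [mul_one_div, div_le_iff₀ hu0]; linarith
    have e8 : 8 / (2 * u) = 4 * (1 / u) := by field_simp; norm_num
    have e4 : 4 / (2 * u) = 2 * (1 / u) := by field_simp; norm_num
    have e200 : 200 * Λ / (2 * u) = 100 * (Λ * (1 / u)) := by field_simp; norm_num
    have e100 : 100 * Λ / (2 * u) = 50 * (Λ * (1 / u)) := by field_simp; norm_num
    have huD : (2 * u) ^ 4 ≤ D := by
      refine le_trans (pow_le_pow_left₀ (by positivity) ?_ 4) hun
      exact le_mul_of_one_le_left (by positivity) (one_le_pow₀ (by norm_num))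
    have h3 := h2.half hr hΛ (by positivity) (by rw [e8]; nlinarith)
      (by rw [e200]; nlinarith [mul_pos (lt_of_lt_of_le one_pos hΛ) hi0]) (by linarith) huD
    rw [show 2 * u / 2 = u by ring] at h3
    refine h3.mono ?_ ?_
    · rw [e8, e4, mul_assoc, show 8 / u = 8 * (1 / u) by ring]
      refine mul_le_mul_of_nonneg_left ?_ (by linarith)
      nlinarith
    · rw [e200, e100, mul_assoc, show 200 * Λ / u = 200 * (Λ * (1 / u)) by ring]
      refine mul_le_mul_of_nonneg_left ?_ (by linarith)
      nlinarith [mul_pos (lt_of_lt_of_le one_pos hΛ) hi0]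

/-- From an almost regular weighting one gets a weighting, with bounded weights, whose degrees are
at most `D` and fall short of `D` by a constant on average. -/
theorem exists_bounded_defect {V : Type*} [Fintype V] [DecidableEq V]
    {r : V → V → Prop} (hr : ∀ x, ¬ r x x) {w : V → V → ℝ} (hw : IsEdgeWeighting r w 1)
    {U : Finset V} (hU : U.Nonempty) {D κ : ℝ} (hκ : 0 < κ) (hκ1 : κ ≤ 1)
    (hD : (200 / κ ^ 2) ^ 4 ≤ D)
    (hdeg : ∀ x ∈ U, weightedDegree w U x ≤ D) (hdeg' : ∀ x ∈ U, κ * D ≤ weightedDegree w U x) :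
    ∃ (U' : Finset V) (w' : V → V → ℝ), U'.Nonempty ∧ IsEdgeWeighting r w' (2 / κ ^ 2) ∧
      (∀ x ∈ U', weightedDegree w' U' x ≤ D) ∧
      ∑ x ∈ U', (D - weightedDegree w' U' x) ≤ 100 / κ ^ 3 * (200 / κ ^ 2) ^ 2 * U'.card := by
  set u₀ := 200 / κ ^ 2 with hu₀
  have hΛ : 1 ≤ 1 / κ ^ 2 := by
    rw [le_div_iff₀ (by positivity), one_mul]; exact pow_le_one₀ hκ.le hκ1
  have hB : 1 ≤ 50 / κ ^ 3 := by
    rw [le_div_iff₀ (by positivity), one_mul]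
    exact (pow_le_one₀ hκ.le hκ1).trans (by norm_num)
  have hu0 : 0 < u₀ := by positivity
  have huΛ : 200 * (1 / κ ^ 2) = u₀ := by rw [hu₀]; ring
  have hD0 : 0 < D := lt_of_lt_of_le (by positivity) hD
  -- The starting scale `2 ^ n * u₀` has fourth power within a factor 16 of `D`, as both the first
  -- step and the iteration require.
  obtain ⟨n, hn1, hn2⟩ := exists_nat_pow_near ((one_le_div (by positivity)).2 hD)
    (show (1 : ℝ) < 16 by norm_num)
  rw [le_div_iff₀ (by positivity)] at hn1
  rw [div_lt_iff₀ (by positivity)] at hn2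
  have e16 : ((2 : ℝ) ^ n) ^ 4 = 16 ^ n := by
    rw [← pow_mul, mul_comm, pow_mul]; norm_num
  have hun : (2 ^ n * u₀) ^ 4 ≤ D := by rw [mul_pow, e16]; exact hn1
  have h1 := HasNearRegularWeighting.of_almostRegular hr hw hU (u := 2 ^ n * u₀) hD0 hκ hκ1
    (by positivity) (by rw [mul_pow, e16]; rw [pow_succ] at hn2; linarith) hdeg hdeg'
  obtain ⟨U', w', a1, a2, a3, a4⟩ := h1.iterate hr hΛ hB huΛ.le n u₀ le_rfl hun
  have hu200 : 200 ≤ u₀ := by rw [← huΛ]; linarith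
  refine ⟨U', w', a1, ⟨a2.symm, a2.nonneg, fun x y => (a2.le x y).trans ?_, a2.supp⟩, a3, ?_⟩
  · have : 8 / u₀ ≤ 1 := by rw [div_le_one hu0]; linarith
    rw [show 2 / κ ^ 2 = 1 / κ ^ 2 * 2 by ring]
    exact mul_le_mul_of_nonneg_left (by linarith) (by positivity)
  · rw [huΛ, div_self hu0.ne', Finset.sum_add_distrib, ← Finset.sum_div U' _ (u₀ ^ 2)] at a4
    have : 0 ≤ ∑ x ∈ U', (D - weightedDegree w' U' x) ^ 2 / D :=
      Finset.sum_nonneg fun x _ => by positivity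
    have h2 : (∑ x ∈ U', (D - weightedDegree w' U' x)) / u₀ ^ 2 ≤
        50 / κ ^ 3 * (1 + 1) * U'.card := by linarith
    rw [div_le_iff₀ (by positivity)] at h2
    refine h2.trans (le_of_eq (by ring))

/-! ### Integrality of the bipartite degree polytope -/

/-- In a bipartite multigraph, if every vertex of `T` meets at least two edges of the nonempty set
`F`, there is a nonzero edge weighting supported on `F` summing to zero at each vertex of `T`. -/
theorem exists_ne_zero_sum_incident_eq_zero {ι V : Type*} [Fintype ι] [Fintype V] [DecidableEq ι]
    [DecidableEq V] (a b : ι → V) (c : V → Bool) (ha : ∀ i, c (a i) = true)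
    (hb : ∀ i, c (b i) = false) (F : Finset ι) (hF : F.Nonempty) (T : Finset V)
    (hT : ∀ v ∈ T, 2 ≤ (F.filter fun i => a i = v ∨ b i = v).card) :
    ∃ x : ι → ℝ, x ≠ 0 ∧ (∀ i ∉ F, x i = 0) ∧
      ∀ v ∈ T, ∑ i with a i = v ∨ b i = v, x i = 0 := by
  have hab : ∀ i, a i ≠ b i := fun i h => by have := ha i; rw [h, hb] at this; simp at this
  let N : Matrix T F ℝ := fun v i => if a i = v ∨ b i = v then 1 else 0
  have hsum : ∀ (x : F → ℝ) (v : T), N.mulVec x v =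
      ∑ i with a i = v ∨ b i = v, if h : i ∈ F then x ⟨i, h⟩ else 0 := by
    intro x v
    simp only [Matrix.mulVec, dotProduct, N, ite_mul, one_mul, zero_mul]
    rw [Finset.sum_filter, ← Finset.sum_subset (Finset.subset_univ F)
      (fun i _ hi => by simp [hi]), ← Finset.sum_coe_sort F]
    exact Finset.sum_congr rfl fun i _ => by simp
  suffices h : ∃ x : F → ℝ, x ≠ 0 ∧ N.mulVec x = 0 by
    obtain ⟨x, hx, hN⟩ := h
    refine ⟨fun i => if h : i ∈ F then x ⟨i, h⟩ else 0, ?_, fun i hi => by simp [hi], ?_⟩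
    · intro h0
      apply hx
      ext i
      simpa using congrFun h0 i
    · intro v hv
      rw [← hsum x ⟨v, hv⟩, hN]; rfl
  have hcount : ∑ v ∈ T, (F.filter fun i => a i = v ∨ b i = v).card =
      ∑ i ∈ F, (T.filter fun v => a i = v ∨ b i = v).card :=
    Finset.sum_card_bipartiteAbove_eq_sum_card_bipartiteBelow (fun v i => a i = v ∨ b i = v)
  have hle : ∀ i ∈ F, (T.filter fun v => a i = v ∨ b i = v).card ≤ 2 := by
    intro i _
    refine (Finset.card_le_card (t := {a i, b i}) fun v hv => ?_).trans Finset.card_le_two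
    simp only [Finset.mem_filter] at hv
    simp only [Finset.mem_insert, Finset.mem_singleton]
    tauto
  have h2T : T.card * 2 ≤ ∑ v ∈ T, (F.filter fun i => a i = v ∨ b i = v).card := by
    rw [← smul_eq_mul]; exact Finset.card_nsmul_le_sum _ _ _ hT
  have h2F : ∑ i ∈ F, (T.filter fun v => a i = v ∨ b i = v).card ≤ F.card * 2 := by
    rw [← smul_eq_mul]; exact Finset.sum_le_card_nsmul _ _ _ hle
  -- Double counting gives `|T| ≤ |F|`. In the case of equality every edge of `F` has both ends in
  -- `T`, and the rows signed by the two sides sum to zero, so the square matrix is singular.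
  have hker : LinearMap.ker N.mulVecLin ≠ ⊥ := by
    rcases lt_or_ge T.card F.card with hlt | hge
    · exact LinearMap.ker_ne_bot_of_finrank_lt (by simpa using hlt)
    · intro hbot
      have hcard : F.card = T.card := by omega
      have hinj : Function.Injective N.mulVecLin := LinearMap.ker_eq_bot.1 hbot
      have hsurj := (LinearMap.injective_iff_surjective_of_finrank_eq_finrank
        (by simpa using hcard)).1 hinj
      have heq : ∀ i ∈ F, (T.filter fun v => a i = v ∨ b i = v).card = 2 := by
        refine (Finset.sum_eq_sum_iff_of_le hle).1 ?_
        rw [Finset.sum_const, smul_eq_mul]; omega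
      have hends : ∀ i ∈ F, a i ∈ T ∧ b i ∈ T := by
        intro i hi
        have hsub : (T.filter fun v => a i = v ∨ b i = v) ⊆ {a i, b i} := fun v hv => by
          simp only [Finset.mem_filter] at hv
          simp only [Finset.mem_insert, Finset.mem_singleton]
          tauto
        have := Finset.eq_of_subset_of_card_le hsub
          (by rw [heq i hi]; exact Finset.card_le_two)
        have h1 : a i ∈ T.filter fun v => a i = v ∨ b i = v := by rw [this]; simp
        have h2 : b i ∈ T.filter fun v => a i = v ∨ b i = v := by rw [this]; simp
        exact ⟨(Finset.mem_filter.1 h1).1, (Finset.mem_filter.1 h2).1⟩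
      let s : V → ℝ := fun v => if c v then 1 else -1
      have hzero : ∀ x : F → ℝ, ∑ v : T, s v * N.mulVec x v = 0 := by
        intro x
        simp only [Matrix.mulVec, dotProduct, Finset.mul_sum]
        rw [Finset.sum_comm]
        refine Finset.sum_eq_zero fun i _ => ?_
        simp only [← mul_assoc, ← Finset.sum_mul]
        obtain ⟨h1, h2⟩ := hends i i.2
        have : ∑ v : T, s v * N v i = 0 := by
          simp only [N]
          rw [Finset.sum_coe_sort T (fun v => s v * if a i = v ∨ b i = v then 1 else 0)]
          rw [← Finset.sum_subset (s₁ := {a i, b i})]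
          · rw [Finset.sum_pair (hab i)]; simp [s, ha, hb]
          · intro v hv
            simp only [Finset.mem_insert, Finset.mem_singleton] at hv
            rcases hv with rfl | rfl <;> assumption
          · intro v _ hv
            simp only [Finset.mem_insert, Finset.mem_singleton, not_or] at hv
            rw [if_neg (by rintro (h | h) <;> simp [h] at hv), mul_zero]
        rw [this, zero_mul]
      obtain ⟨i, hi⟩ := hF
      obtain ⟨x, hx⟩ := hsurj (Pi.single ⟨a i, (hends i hi).1⟩ 1)
      have h0 := hzero x
      rw [Matrix.mulVecLin_apply] at hx
      simp [hx, Pi.single_apply, s, ha] at h0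
  obtain ⟨x, hx, hx0⟩ := Submodule.exists_mem_ne_zero_of_ne_bot hker
  exact ⟨x, hx0, by simpa using hx⟩

/-- A fractional subgraph of a bipartite multigraph with degrees at most `k` can be rounded to a
subgraph with degrees at most `k` and at least the same total weight. -/
theorem exists_rounding {ι V : Type*} [Fintype ι] [Fintype V] [DecidableEq ι]
    [DecidableEq V] (a b : ι → V) (c : V → Bool) (ha : ∀ i, c (a i) = true)
    (hb : ∀ i, c (b i) = false) (k : ℕ) (z : ι → ℝ) (hz0 : ∀ i, 0 ≤ z i) (hz1 : ∀ i, z i ≤ 1)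
    (hz : ∀ v, ∑ i with a i = v ∨ b i = v, z i ≤ k) :
    ∃ F : Finset ι, (∀ v, (F.filter fun i => a i = v ∨ b i = v).card ≤ k) ∧
      ∑ i, z i ≤ F.card := by
  let P : Set (ι → ℝ) := Set.Icc 0 1 ∩ {y | ∀ v, ∑ i with a i = v ∨ b i = v, y i ≤ k}
  have hPc : IsCompact P := by
    refine isCompact_Icc.inter_right ?_
    simp only [Set.ofPred_forall]
    exact isClosed_iInter fun v => isClosed_le (by fun_prop) continuous_const
  have hzP : z ∈ P := ⟨⟨hz0, hz1⟩, hz⟩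
  have hlc : Continuous fun y : ι → ℝ => ∑ i, y i := by fun_prop
  obtain ⟨m, hmP, hm⟩ := hPc.exists_isMaxOn ⟨z, hzP⟩ hlc.continuousOn
  -- The optimal face. An extreme point of it will be integral.
  let M : Set (ι → ℝ) := P ∩ {y | ∑ i, m i ≤ ∑ i, y i}
  have hMc : IsCompact M := hPc.inter_right (isClosed_le continuous_const hlc)
  obtain ⟨y, hy⟩ := hMc.extremePoints_nonempty ⟨m, hmP, le_refl (∑ i, m i)⟩
  rw [mem_extremePoints] at hy
  obtain ⟨⟨⟨⟨hy0, hy1⟩, hyk⟩, hym⟩, hext⟩ := hy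
  simp only [Set.mem_ofPred_eq] at hyk hym
  have hint : ∀ i, y i = 0 ∨ y i = 1 := by
    by_contra hcon
    push Not at hcon
    let F : Finset ι := Finset.univ.filter fun i => y i ≠ 0 ∧ y i ≠ 1
    have hF : F.Nonempty := by
      obtain ⟨i, hi⟩ := hcon; exact ⟨i, by simpa [F] using hi⟩
    let T : Finset V := Finset.univ.filter fun v => ∑ i with a i = v ∨ b i = v, y i = k ∧
      ∃ i ∈ F, a i = v ∨ b i = v
    -- A single fractional edge at `v` would make the integer `k` an integer plus a fraction.
    have hT : ∀ v ∈ T, 2 ≤ (F.filter fun i => a i = v ∨ b i = v).card := by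
      intro v hv
      simp only [T, Finset.mem_filter, Finset.mem_univ, true_and] at hv
      obtain ⟨hk, j, hjF, hjv⟩ := hv
      by_contra hlt
      have hj : j ∈ F.filter fun i => a i = v ∨ b i = v := by simp [hjF, hjv]
      have hc1 : (F.filter fun i => a i = v ∨ b i = v).card = 1 := by
        have := Finset.card_pos.2 ⟨j, hj⟩; omega
      obtain ⟨j', hj'⟩ := Finset.card_eq_one.1 hc1
      rw [hj', Finset.mem_singleton] at hj
      subst hj
      have hoff : ∀ i ∈ (Finset.univ.filter fun i => a i = v ∨ b i = v).erase j,
          y i = ((if y i = 1 then 1 else 0 : ℤ) : ℝ) := by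
        intro i hi
        have hiF : i ∉ F := by
          intro hiF
          have : i ∈ F.filter fun i => a i = v ∨ b i = v := by
            simp only [Finset.mem_erase, Finset.mem_filter] at hi ⊢
            exact ⟨hiF, hi.2.2⟩
          rw [hj', Finset.mem_singleton] at this
          simp [this] at hi
        simp only [F, Finset.mem_filter, Finset.mem_univ, true_and, not_and_or, not_not] at hiF
        rcases hiF with h | h <;> simp [h]
      rw [← Finset.add_sum_erase _ _ (by simp [hjv] : j ∈ Finset.univ.filter
        fun i => a i = v ∨ b i = v), Finset.sum_congr rfl hoff, ← Int.cast_sum] at hk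
      set S : ℤ := ∑ i ∈ (Finset.univ.filter fun i => a i = v ∨ b i = v).erase j,
        (if y i = 1 then 1 else 0)
      have e : y j = ((k - S : ℤ) : ℝ) := by push_cast; linarith
      simp only [F, Finset.mem_filter, Finset.mem_univ, true_and] at hjF
      have h1 := lt_of_le_of_ne (hy0 j) (Ne.symm hjF.1)
      have h2 := lt_of_le_of_ne (hy1 j) hjF.2
      rw [e] at h1 h2
      simp only [Pi.zero_apply, Pi.one_apply] at h1 h2
      have h1' : (0 : ℤ) < k - S := by exact_mod_cast h1
      have h2' : (k - S : ℤ) < 1 := by exact_mod_cast h2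
      omega
    obtain ⟨x, hx0, hxF, hxT⟩ := exists_ne_zero_sum_incident_eq_zero a b c ha hb F hF T hT
    -- Moving along `x` preserves the tight constraints and, for small `η`, the slack ones. Moving
    -- both ways contradicts extremality.
    have hev : ∀ᶠ η : ℝ in nhds 0, (fun i => y i + η * x i) ∈ P := by
      have h1 : ∀ i, ∀ᶠ η : ℝ in nhds 0, 0 ≤ y i + η * x i ∧ y i + η * x i ≤ 1 := by
        intro i
        by_cases hi : i ∈ F
        · have hct : Continuous fun η : ℝ => y i + η * x i := by fun_prop
          have hi' := hi
          simp only [F, Finset.mem_filter, Finset.mem_univ, true_and] at hi'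
          have := (hct.tendsto' 0 (y i) (by simp)).eventually
            (Ioo_mem_nhds (lt_of_le_of_ne (hy0 i) (Ne.symm hi'.1)) (lt_of_le_of_ne (hy1 i) hi'.2))
          filter_upwards [this] with η hη using ⟨hη.1.le, hη.2.le⟩
        · simp only [hxF i hi, mul_zero, add_zero]
          exact Filter.Eventually.of_forall fun _ => ⟨hy0 i, hy1 i⟩
      have h2 : ∀ v, ∀ᶠ η : ℝ in nhds 0,
          ∑ i with a i = v ∨ b i = v, (y i + η * x i) ≤ k := by
        intro v
        rcases (hyk v).lt_or_eq with hlt | heq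
        · have hct : Continuous fun η : ℝ => ∑ i with a i = v ∨ b i = v, (y i + η * x i) := by
            fun_prop
          have := (hct.tendsto' 0 (∑ i with a i = v ∨ b i = v, y i) (by simp)).eventually
            (Iio_mem_nhds hlt)
          filter_upwards [this] with η hη using le_of_lt hη
        · refine Filter.Eventually.of_forall fun η => ?_
          rw [Finset.sum_add_distrib, ← Finset.mul_sum]
          have : ∑ i with a i = v ∨ b i = v, x i = 0 := by
            by_cases hv : v ∈ T
            · exact hxT v hv
            · refine Finset.sum_eq_zero fun i hi => hxF i fun hiF => hv ?_
              simp only [T, Finset.mem_filter, Finset.mem_univ, true_and] at hi ⊢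
              exact ⟨heq, i, hiF, hi⟩
          rw [this, mul_zero, add_zero, heq]
      filter_upwards [Filter.eventually_all.2 h1, Filter.eventually_all.2 h2] with η e1 e2
      exact ⟨⟨fun i => (e1 i).1, fun i => (e1 i).2⟩, e2⟩
    have hev' : ∀ᶠ η : ℝ in nhds 0, (fun i => y i + (-η) * x i) ∈ P :=
      (continuous_neg.tendsto' (0 : ℝ) 0 neg_zero).eventually hev
    obtain ⟨δ, hδ, hball⟩ := Metric.eventually_nhds_iff.1 (hev.and hev')
    obtain ⟨hp, hn⟩ := hball (y := δ / 2) (by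
      rw [Real.dist_eq, sub_zero, abs_of_pos (by positivity)]; linarith)
    have sp : ∑ i, (y i + δ / 2 * x i) ≤ ∑ i, m i := hm hp
    have sn : ∑ i, (y i + -(δ / 2) * x i) ≤ ∑ i, m i := hm hn
    rw [Finset.sum_add_distrib, ← Finset.mul_sum] at sp sn
    have hpM : (fun i => y i + δ / 2 * x i) ∈ M := by
      refine ⟨hp, ?_⟩
      simp only [Set.mem_ofPred_eq]
      rw [Finset.sum_add_distrib, ← Finset.mul_sum]; linarith
    have hnM : (fun i => y i + -(δ / 2) * x i) ∈ M := by
      refine ⟨hn, ?_⟩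
      simp only [Set.mem_ofPred_eq]
      rw [Finset.sum_add_distrib, ← Finset.mul_sum]; linarith
    have hseg : y ∈ openSegment ℝ (fun i => y i + δ / 2 * x i) (fun i => y i + -(δ / 2) * x i) := by
      refine ⟨1 / 2, 1 / 2, by norm_num, by norm_num, by norm_num, ?_⟩
      ext i
      simp only [Pi.add_apply, Pi.smul_apply, smul_eq_mul]; ring
    have := (hext _ hpM _ hnM hseg).1
    apply hx0
    ext i
    have h := congrFun this i
    simp only [add_eq_left, mul_eq_zero] at h
    rcases h with h | h
    · linarith
    · exact h
  have hyi : ∀ i, y i = if y i = 1 then 1 else 0 := fun i => by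
    rcases hint i with h | h <;> simp [h]
  refine ⟨Finset.univ.filter fun i => y i = 1, fun v => ?_, ?_⟩
  · have h := hyk v
    rw [Finset.sum_congr rfl fun i _ => hyi i, Finset.sum_boole] at h
    rw [Finset.filter_filter] at h ⊢
    simp only [and_comm (a := _ = (1 : ℝ))]
    exact_mod_cast h
  · have h : ∑ i, z i ≤ ∑ i, m i := hm hzP
    refine (h.trans hym).trans (le_of_eq ?_)
    rw [Finset.sum_congr rfl fun i _ => hyi i, Finset.sum_boole]

/-! ### Regular subgraphs by Chevalley–Warning and rounding -/

/-- Alon, Friedland and Kalai: a hypergraph incidence structure with more than `(p - 1) |U|` edges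
and degrees less than `2 p` on `U` has a nonempty set of edges with all degrees `0` or `p`. -/
theorem exists_degrees_eq_zero_or_prime {ι V : Type*} [Fintype ι] [DecidableEq ι] (p : ℕ)
    [hp : Fact p.Prime] (inc : V → ι → Prop) [∀ v, DecidablePred (inc v)] (U : Finset V)
    (hcard : U.card * (p - 1) < Fintype.card ι)
    (hdeg : ∀ v ∈ U, (Finset.univ.filter (inc v)).card < 2 * p) :
    ∃ F : Finset ι, F.Nonempty ∧
      ∀ v ∈ U, (F.filter (inc v)).card = 0 ∨ (F.filter (inc v)).card = p := by
  classical
  have hp1 : p - 1 ≠ 0 := by have := hp.out.two_le; omega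
  -- By Fermat `X ^ (p - 1)` indicates a nonzero coordinate, so common zeros are edge sets with
  -- degrees divisible by `p`. Chevalley–Warning supplies one besides the trivial zero.
  let f : V → MvPolynomial ι (ZMod p) := fun v =>
    ∑ i with inc v i, MvPolynomial.X i ^ (p - 1)
  have hf : ∀ v ∈ U, (f v).totalDegree ≤ p - 1 := by
    intro v _
    refine (MvPolynomial.totalDegree_finsetSum _ _).trans (Finset.sup_le fun i _ => ?_)
    rw [MvPolynomial.totalDegree_X_pow]
  have hlt : ∑ v ∈ U, (f v).totalDegree < Fintype.card ι := by
    refine lt_of_le_of_lt (Finset.sum_le_card_nsmul _ _ _ hf) ?_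
    rwa [smul_eq_mul]
  have hdvd := char_dvd_card_solutions_of_sum_lt p hlt
  let s0 : {x : ι → ZMod p // ∀ v ∈ U, MvPolynomial.eval x (f v) = 0} :=
    ⟨0, fun v _ => by simp [f, hp1]⟩
  have hcard1 : 1 < Fintype.card {x : ι → ZMod p // ∀ v ∈ U, MvPolynomial.eval x (f v) = 0} :=
    lt_of_lt_of_le hp.out.one_lt (Nat.le_of_dvd (Fintype.card_pos_iff.2 ⟨s0⟩) hdvd)
  obtain ⟨⟨x, hx⟩, hne⟩ := Fintype.exists_ne_of_one_lt_card hcard1 s0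
  have hx0 : x ≠ 0 := fun h => hne (Subtype.ext h)
  refine ⟨Finset.univ.filter fun i => x i ≠ 0, ?_, fun v hv => ?_⟩
  · obtain ⟨i, hi⟩ := Function.ne_iff.1 hx0
    exact ⟨i, by simpa using hi⟩
  · have h := hx v hv
    simp only [f, map_sum, map_pow, MvPolynomial.eval_X] at h
    have e : ∀ i, x i ^ (p - 1) = if x i ≠ 0 then 1 else 0 := by
      intro i
      split_ifs with hi
      · exact ZMod.pow_card_sub_one_eq_one hi
      · rw [not_not.1 hi, zero_pow hp1]
    rw [Finset.sum_congr rfl fun i _ => e i, Finset.sum_boole, Finset.filter_filter,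
      ZMod.natCast_eq_zero_iff] at h
    rw [Finset.filter_filter]
    simp only [and_comm (a := x _ ≠ 0)]
    have hle : (Finset.univ.filter fun i => inc v i ∧ x i ≠ 0).card < 2 * p :=
      lt_of_le_of_lt (Finset.card_le_card fun i hi => by
        simp only [Finset.mem_filter] at hi ⊢; exact ⟨hi.1, hi.2.1⟩) (hdeg v hv)
    obtain ⟨k, hk⟩ := h
    have hk2 : k < 2 := by
      rw [hk, mul_comm] at hle
      exact lt_of_mul_lt_mul_right hle (Nat.zero_le _)
    rw [hk]
    interval_cases k <;> simp

/-- A regular bipartite multigraph of degree `p` contains a regular submultigraph of every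
positive degree `r ≤ p`. -/
theorem exists_regular_of_regular {ι V : Type*} [Fintype ι] [Nonempty ι] [Fintype V]
    [DecidableEq ι] [DecidableEq V] (a b : ι → V) (c : V → Bool) (ha : ∀ i, c (a i) = true)
    (hb : ∀ i, c (b i) = false) {p r : ℕ} (hr : 0 < r) (hrp : r ≤ p)
    (hdeg : ∀ v, (Finset.univ.filter fun i => a i = v ∨ b i = v).card = 0 ∨
      (Finset.univ.filter fun i => a i = v ∨ b i = v).card = p) :
    ∃ F : Finset ι, F.Nonempty ∧ ∀ v, (F.filter fun i => a i = v ∨ b i = v).card = 0 ∨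
      (F.filter fun i => a i = v ∨ b i = v).card = r := by
  have hab : ∀ i, a i ≠ b i := fun i h => by have := ha i; rw [h, hb] at this; simp at this
  have hp : (0 : ℝ) < p := by exact_mod_cast hr.trans_le hrp
  have hcount : ∀ F : Finset ι, ∑ v, (F.filter fun i => a i = v ∨ b i = v).card = 2 * F.card := by
    intro F
    have h := Finset.sum_card_bipartiteAbove_eq_sum_card_bipartiteBelow (s := Finset.univ) (t := F)
      (fun (v : V) i => a i = v ∨ b i = v)
    simp only [Finset.bipartiteAbove, Finset.bipartiteBelow] at h
    rw [h, Finset.sum_const_nat (m := 2), mul_comm]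
    intro i _
    rw [show (Finset.univ.filter fun v => a i = v ∨ b i = v) = {a i, b i} by
      ext v; simp [eq_comm]]
    exact Finset.card_pair (hab i)
  obtain ⟨F, hF, hcard⟩ := exists_rounding a b c ha hb r (fun _ => (r : ℝ) / p)
    (fun _ => by positivity) (fun _ => (div_le_one hp).2 (by exact_mod_cast hrp)) (fun v => by
      rw [Finset.sum_const, nsmul_eq_mul]
      rcases hdeg v with h | h <;> rw [h]
      · simp
      · rw [mul_div_cancel₀ _ hp.ne'])
  have hcard' : r * Fintype.card ι ≤ p * F.card := by
    rw [Finset.sum_const, nsmul_eq_mul, Finset.card_univ, mul_div_assoc', div_le_iff₀ hp] at hcard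
    have : Fintype.card ι * r ≤ F.card * p := by exact_mod_cast hcard
    linarith
  have hle : ∀ v ∈ (Finset.univ : Finset V), p * (F.filter fun i => a i = v ∨ b i = v).card ≤
      r * (Finset.univ.filter fun i => a i = v ∨ b i = v).card := by
    intro v _
    rcases hdeg v with h | h
    · have : (F.filter fun i => a i = v ∨ b i = v).card ≤ 0 :=
        h ▸ Finset.card_le_card (Finset.filter_subset_filter _ (Finset.subset_univ F))
      rw [Nat.le_zero.1 this]; simp
    · rw [h, mul_comm r]; exact Nat.mul_le_mul_left _ (hF v)
  -- The edge count of `F` meets the total allowed by the degree bounds, so each bound is an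
  -- equality.
  have heq := (Finset.sum_eq_sum_iff_of_le hle).1 (by
    refine le_antisymm (Finset.sum_le_sum hle) ?_
    rw [← Finset.mul_sum, ← Finset.mul_sum, hcount, hcount, Finset.card_univ]
    linarith)
  have hp' : 0 < p := hr.trans_le hrp
  refine ⟨F, ?_, fun v => ?_⟩
  · rw [← Finset.card_pos]
    exact pos_of_mul_pos_right (lt_of_lt_of_le (Nat.mul_pos hr Fintype.card_pos) hcard')
      (Nat.zero_le _)
  · have h := heq v (Finset.mem_univ v)
    rcases hdeg v with h0 | h0 <;> rw [h0] at h
    · left; simpa [hp'.ne'] using h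
    · right; rw [mul_comm r] at h; exact Nat.eq_of_mul_eq_mul_left hp' h

/-- A fractional subgraph of a bipartite multigraph with degrees at most `2 p - 1` and average
degree greater than `2 p - 2`, with `p` prime, forces regular subgraphs of every positive degree
`r ≤ p`. -/
theorem exists_regular_of_fractional {ι V : Type*} [Fintype ι] [Fintype V]
    [DecidableEq ι] [DecidableEq V] (a b : ι → V) (c : V → Bool) (ha : ∀ i, c (a i) = true)
    (hb : ∀ i, c (b i) = false) (U : Finset V) (haU : ∀ i, a i ∈ U) (hbU : ∀ i, b i ∈ U)
    {p r : ℕ} (hp : p.Prime) (hr : 0 < r) (hrp : r ≤ p)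
    (z : ι → ℝ) (hz0 : ∀ i, 0 ≤ z i) (hz1 : ∀ i, z i ≤ 1)
    (hz : ∀ v, ∑ i with a i = v ∨ b i = v, z i ≤ ((2 * p - 1 : ℕ) : ℝ))
    (hsum : (U.card : ℝ) * ((p - 1 : ℕ) : ℝ) < ∑ i, z i) :
    ∃ F : Finset ι, F.Nonempty ∧ ∀ v, (F.filter fun i => a i = v ∨ b i = v).card = 0 ∨
      (F.filter fun i => a i = v ∨ b i = v).card = r := by
  have := Fact.mk hp
  have hp0 := hp.pos
  have hmap : ∀ (S : Finset ι) (T : Finset S) (v : V),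
      ((T.map (Function.Embedding.subtype _)).filter fun i => a i = v ∨ b i = v).card =
        (T.filter fun i : S => a i = v ∨ b i = v).card := by
    intro S T v
    rw [Finset.filter_map, Finset.card_map]; rfl
  obtain ⟨F₁, hF₁, hc₁⟩ := exists_rounding a b c ha hb _ z hz0 hz1 hz
  obtain ⟨F₂, hF₂, hd₂⟩ := exists_degrees_eq_zero_or_prime (ι := F₁) p
    (fun v i => a i = v ∨ b i = v) U
    (by rw [Fintype.card_coe]; exact_mod_cast hsum.trans_le hc₁)
    (fun v _ => by
      rw [← hmap F₁ Finset.univ v]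
      refine lt_of_le_of_lt ((Finset.card_le_card (Finset.filter_subset_filter _ ?_)).trans
        (hF₁ v)) (by omega)
      intro i hi
      obtain ⟨j, -, rfl⟩ := Finset.mem_map.1 hi
      exact j.2)
  have hd₂' : ∀ v, (F₂.filter fun i : F₁ => a i = v ∨ b i = v).card = 0 ∨
      (F₂.filter fun i : F₁ => a i = v ∨ b i = v).card = p := by
    intro v
    by_cases hv : v ∈ U
    · exact hd₂ v hv
    · left
      rw [Finset.card_eq_zero, Finset.filter_eq_empty_iff]
      rintro i - (h | h)
      · exact hv (h ▸ haU i)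
      · exact hv (h ▸ hbU i)
  set S := F₂.map (Function.Embedding.subtype _) with hS
  have : Nonempty S := by
    have : S.Nonempty := by rw [hS, Finset.map_nonempty]; exact hF₂
    exact this.to_subtype
  obtain ⟨F₃, hF₃, hd₃⟩ := exists_regular_of_regular (ι := S) (fun i => a i) (fun i => b i) c
    (fun i => ha i) (fun i => hb i) hr hrp (fun v => by
      rw [← hmap S Finset.univ v]
      have : (Finset.univ : Finset S).map (Function.Embedding.subtype _) = S := by
        ext i; simp
      rw [this, hS, hmap]
      exact hd₂' v)
  refine ⟨F₃.map (Function.Embedding.subtype _), by rwa [Finset.map_nonempty], fun v => ?_⟩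
  rw [hmap]
  exact hd₃ v

/-! ### Passing between weightings and graphs -/

/-- A nonempty set of edges of a graph, all of whose degrees are `0` or `r`, spans an `r`-regular
subgraph. -/
theorem SimpleGraph.ContainsRegularSubgraph.of_edges {ι V : Type*} [Fintype V] [DecidableEq ι]
    [DecidableEq V] {G : SimpleGraph V} (a b : ι → V) (c : V → Bool) (ha : ∀ i, c (a i) = true)
    (hb : ∀ i, c (b i) = false) (hadj : ∀ i, G.Adj (a i) (b i))
    (hinj : ∀ i j, a i = a j → b i = b j → i = j) {r : ℕ} (F : Finset ι) (hF : F.Nonempty)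
    (hdeg : ∀ v, (F.filter fun i => a i = v ∨ b i = v).card = 0 ∨
      (F.filter fun i => a i = v ∨ b i = v).card = r) : G.ContainsRegularSubgraph r := by
  classical
  have hab : ∀ i j, a i ≠ b j := fun i j h => by have := ha i; rw [h, hb] at this; simp at this
  let H : G.Subgraph :=
    { verts := {v | ∃ i ∈ F, a i = v ∨ b i = v}
      Adj := fun u v => ∃ i ∈ F, (a i = u ∧ b i = v) ∨ (b i = u ∧ a i = v)
      adj_sub := by
        rintro u v ⟨i, _, ⟨rfl, rfl⟩ | ⟨rfl, rfl⟩⟩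
        · exact hadj i
        · exact (hadj i).symm
      edge_vert := by
        rintro u v ⟨i, hi, ⟨rfl, rfl⟩ | ⟨rfl, rfl⟩⟩
        · exact ⟨i, hi, Or.inl rfl⟩
        · exact ⟨i, hi, Or.inr rfl⟩
      symm := ⟨by
        rintro u v ⟨i, hi, h | h⟩
        · exact ⟨i, hi, Or.inr ⟨h.2, h.1⟩⟩
        · exact ⟨i, hi, Or.inl ⟨h.2, h.1⟩⟩⟩ }
  obtain ⟨i₀, hi₀⟩ := hF
  refine ⟨H, ⟨a i₀, i₀, hi₀, Or.inl rfl⟩, fun v => Fintype.ofFinite _, ?_⟩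
  rintro ⟨v, i₁, hi₁, hv⟩
  have hr : (F.filter fun i => a i = v ∨ b i = v).card = r := by
    refine (hdeg v).resolve_left fun h => ?_
    rw [Finset.card_eq_zero, Finset.filter_eq_empty_iff] at h
    exact h hi₁ hv
  have hother : ∀ i ∈ F, a i = v ∨ b i = v → H.Adj v (if a i = v then b i else a i) := by
    intro i hi h
    by_cases hav : a i = v
    · rw [if_pos hav]; exact ⟨i, hi, Or.inl ⟨hav, rfl⟩⟩
    · rw [if_neg hav]; exact ⟨i, hi, Or.inr ⟨h.resolve_left hav, rfl⟩⟩
  rw [← hr, SimpleGraph.degree]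
  symm
  refine Finset.card_bij (fun i hi => ⟨if a i = v then b i else a i,
    H.edge_vert (hother i (Finset.mem_filter.1 hi).1 (Finset.mem_filter.1 hi).2).symm⟩) ?_ ?_ ?_
  · intro i hi
    rw [SimpleGraph.mem_neighborFinset]
    exact hother i (Finset.mem_filter.1 hi).1 (Finset.mem_filter.1 hi).2
  · intro i hi j hj hij
    have hi' := (Finset.mem_filter.1 hi).2
    have hj' := (Finset.mem_filter.1 hj).2
    simp only [Subtype.mk.injEq] at hij
    by_cases h1 : a i = v <;> by_cases h2 : a j = v
    · rw [if_pos h1, if_pos h2] at hij; exact hinj i j (h1.trans h2.symm) hij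
    · exact absurd (h1.trans (hj'.resolve_left h2).symm) (hab i j)
    · exact absurd (h2.trans (hi'.resolve_left h1).symm) (hab j i)
    · rw [if_neg h1, if_neg h2] at hij
      exact hinj i j hij ((hi'.resolve_left h1).trans (hj'.resolve_left h2).symm)
  · rintro ⟨u, hu⟩ h
    rw [SimpleGraph.mem_neighborFinset] at h
    obtain ⟨i, hi, ⟨h1, h2⟩ | ⟨h1, h2⟩⟩ := (h : H.Adj v u)
    · exact ⟨i, Finset.mem_filter.2 ⟨hi, Or.inl h1⟩, by simp [h1, h2]⟩
    · refine ⟨i, Finset.mem_filter.2 ⟨hi, Or.inr h1⟩, ?_⟩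
      have : a i ≠ v := fun h => hab i i (h.trans h1.symm)
      exact Subtype.ext ((if_neg this).trans h2)

/-- A weighting of total weight greater than `α |V|` has all degrees at least `α / 2` on some
nonempty set. -/
theorem exists_le_weightedDegree {V : Type*} [Fintype V] [DecidableEq V] (w : V → V → ℝ)
    (hs : ∀ x y, w x y = w y x) (h0 : ∀ x, w x x = 0) (α : ℝ)
    (hα : α * Fintype.card V < ∑ x, ∑ y, w x y) :
    ∃ U : Finset V, U.Nonempty ∧ ∀ x ∈ U, α / 2 ≤ weightedDegree w U x := by
  -- Removing `x` from a maximiser changes the value by `α` minus twice its degree, which cannot be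
  -- positive.
  obtain ⟨U, -, hU⟩ := Finset.exists_max_image Finset.univ
    (fun U : Finset V => ∑ x ∈ U, ∑ y ∈ U, w x y - α * U.card) Finset.univ_nonempty
  refine ⟨U, ?_, fun x hx => ?_⟩
  · rw [Finset.nonempty_iff_ne_empty]
    rintro rfl
    have := hU Finset.univ (Finset.mem_univ _)
    simp only [Finset.sum_empty, Finset.card_empty, Nat.cast_zero, Finset.card_univ] at this
    linarith
  · have h := hU (U.erase x) (Finset.mem_univ _)
    have e1 : ∑ u ∈ U, ∑ y ∈ U, w u y = ∑ u ∈ U.erase x, ∑ y ∈ U.erase x, w u y +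
        2 * weightedDegree w U x := by
      have e2 : ∀ u, ∑ y ∈ U, w u y = ∑ y ∈ U.erase x, w u y + w u x := fun u =>
        (Finset.sum_erase_add U _ hx).symm
      rw [← Finset.sum_erase_add U _ hx]
      simp only [e2 (_ : V), Finset.sum_add_distrib]
      simp only [weightedDegree, e2 x, h0, hs _ x]
      ring
    have e3 : ((U.erase x).card : ℝ) = U.card - 1 := by
      rw [Finset.card_erase_of_mem hx, Nat.cast_sub (Finset.card_pos.2 ⟨x, hx⟩), Nat.cast_one]
    simp only [e1, e3] at h
    linarith

/-- A bipartite weighting with bounded weights and bounded average defect yields regular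
subgraphs. -/
theorem SimpleGraph.ContainsRegularSubgraph.of_weighting {V : Type*} [Fintype V]
    {G : SimpleGraph V} (c : V → Bool) {w : V → V → ℝ} {L D S A : ℝ}
    (hw : IsEdgeWeighting (fun x y => G.Adj x y ∧ c x ≠ c y) w L) {U : Finset V}
    (hU : U.Nonempty) (hdeg : ∀ x ∈ U, weightedDegree w U x ≤ D)
    (hdef : ∑ x ∈ U, (D - weightedDegree w U x) ≤ S * U.card) (hA : 0 < A) (hLA : L ≤ A)
    (hSA : S < A) {r : ℕ} (hr : 0 < r) (hrD : 4 * r * A ≤ D) : G.ContainsRegularSubgraph r := by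
  classical
  obtain ⟨p, hp, hrp, hp2⟩ := Nat.exists_prime_lt_and_le_two_mul r hr.ne'
  have hr' : (0 : ℝ) < r := by exact_mod_cast hr
  have hD : 0 < D := lt_of_lt_of_le (by positivity) hrD
  have hn : (0 : ℝ) < U.card := by exact_mod_cast hU.card_pos
  -- The largest degree below `2 * p`. After scaling by `k / D` the average defect is under 1, so
  -- the average degree exceeds `k - 1 = 2 * (p - 1)`.
  set k : ℕ := 2 * p - 1 with hk
  have hp1 := hp.one_lt
  have hk1 : (k : ℝ) = 2 * ((p - 1 : ℕ) : ℝ) + 1 := by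
    have : k = 2 * (p - 1) + 1 := by omega
    rw [this]; push_cast; ring
  have hk0 : (0 : ℝ) < k := by rw [hk1]; positivity
  have hkA : k * A ≤ D := by
    refine le_trans (mul_le_mul_of_nonneg_right ?_ hA.le) hrD
    have : k ≤ 4 * r := by omega
    exact_mod_cast this
  have hkD : (k : ℝ) / D * A ≤ 1 := by rw [div_mul_eq_mul_div]; exact (div_le_one hD).2 hkA
  have hkD0 : 0 < (k : ℝ) / D := by positivity
  let ι := {e : V × V // (c e.1 = true ∧ c e.2 = false) ∧ G.Adj e.1 e.2 ∧ e.1 ∈ U ∧ e.2 ∈ U}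
  let a : ι → V := fun i => i.1.1
  let b : ι → V := fun i => i.1.2
  have ha : ∀ i, c (a i) = true := fun i => i.2.1.1
  have hb : ∀ i, c (b i) = false := fun i => i.2.1.2
  have hab : ∀ i j, a i ≠ b j := fun i j h => by have := ha i; rw [h, hb] at this; simp at this
  have hinj : ∀ i j : ι, a i = a j → b i = b j → i = j := fun i j h1 h2 =>
    Subtype.ext (Prod.ext h1 h2)
  have hinc : ∀ x ∈ U, ∑ i with a i = x ∨ b i = x, w (a i) (b i) = weightedDegree w U x := by
    intro x hx
    refine Finset.sum_of_injOn (fun i => if a i = x then b i else a i) ?_ ?_ ?_ ?_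
    · intro i hi j hj hij
      simp only [Finset.coe_filter, Finset.mem_univ, true_and, Set.mem_ofPred_eq] at hi hj
      simp only [] at hij
      by_cases h1 : a i = x <;> by_cases h2 : a j = x
      · rw [if_pos h1, if_pos h2] at hij; exact hinj i j (h1.trans h2.symm) hij
      · exact absurd (h1.trans (hj.resolve_left h2).symm) (hab i j)
      · exact absurd (h2.trans (hi.resolve_left h1).symm) (hab j i)
      · rw [if_neg h1, if_neg h2] at hij
        exact hinj i j hij ((hi.resolve_left h1).trans (hj.resolve_left h2).symm)
    · intro i _
      simp only []
      split_ifs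
      · exact i.2.2.2.2
      · exact i.2.2.2.1
    · intro y hy hyi
      by_contra hne
      obtain ⟨hadj, hc⟩ := hw.supp x y hne
      apply hyi
      cases hcx : c x
      · have hcy : c y = true := by rw [hcx] at hc; cases h : c y <;> simp_all
        refine ⟨⟨(y, x), ⟨hcy, hcx⟩, hadj.symm, hy, hx⟩, ?_, ?_⟩
        · simp [b]
        · simp [a, hadj.ne']
      · have hcy : c y = false := by rw [hcx] at hc; cases h : c y <;> simp_all
        refine ⟨⟨(x, y), ⟨hcx, hcy⟩, hadj, hx, hy⟩, ?_, ?_⟩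
        · simp [a]
        · simp [a, b]
    · intro i hi
      simp only [Finset.mem_filter, Finset.mem_univ, true_and] at hi
      by_cases h : a i = x
      · rw [if_pos h, h]
      · rw [if_neg h, hi.resolve_left h, hw.symm]
  have htot : ∑ x ∈ U, weightedDegree w U x = 2 * ∑ i : ι, w (a i) (b i) := by
    rw [← Finset.sum_congr rfl hinc]
    simp only [Finset.sum_filter]
    rw [Finset.sum_comm, Finset.mul_sum]
    refine Finset.sum_congr rfl fun i _ => ?_
    rw [← Finset.sum_filter, Finset.sum_const, nsmul_eq_mul]
    congr 1
    rw [show (U.filter fun x => a i = x ∨ b i = x) = {a i, b i} by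
      ext x
      simp only [Finset.mem_filter, Finset.mem_insert, Finset.mem_singleton]
      constructor
      · rintro ⟨_, h | h⟩ <;> simp [h]
      · rintro (rfl | rfl)
        · exact ⟨i.2.2.2.1, Or.inl rfl⟩
        · exact ⟨i.2.2.2.2, Or.inr rfl⟩, Finset.card_pair (hab i i)]
    norm_num
  obtain ⟨F, hF, hFd⟩ := exists_regular_of_fractional a b c ha hb U (fun i => i.2.2.2.1)
    (fun i => i.2.2.2.2) hp hr hrp.le (fun i => k / D * w (a i) (b i))
    (fun i => mul_nonneg hkD0.le (hw.nonneg _ _))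
    (fun i => (mul_le_mul_of_nonneg_left ((hw.le _ _).trans hLA) hkD0.le).trans hkD)
    (fun v => by
      rw [← Finset.mul_sum]
      by_cases hv : v ∈ U
      · rw [hinc v hv]
        calc (k : ℝ) / D * weightedDegree w U v ≤ k / D * D :=
              mul_le_mul_of_nonneg_left (hdeg v hv) hkD0.le
          _ = k := div_mul_cancel₀ _ hD.ne'
      · rw [Finset.sum_eq_zero, mul_zero]
        · exact Nat.cast_nonneg _
        · intro i hi
          simp only [Finset.mem_filter, Finset.mem_univ, true_and] at hi
          rcases hi with h | h
          · exact absurd (h ▸ i.2.2.2.1) hv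
          · exact absurd (h ▸ i.2.2.2.2) hv)
    (by
      rw [← Finset.mul_sum]
      rw [Finset.sum_sub_distrib, Finset.sum_const, nsmul_eq_mul, htot] at hdef
      have h1 : U.card * (D - S) / 2 ≤ ∑ i : ι, w (a i) (b i) := by linarith
      refine lt_of_lt_of_le ?_ (mul_le_mul_of_nonneg_left h1 hkD0.le)
      have h2 : (k : ℝ) / D * S < 1 := (mul_lt_mul_of_pos_left hSA hkD0).trans_le hkD
      have h3 : (k : ℝ) / D * (U.card * (D - S) / 2) = U.card * ((k - k / D * S) / 2) := by
        field_simp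
      rw [h3]
      refine mul_lt_mul_of_pos_left ?_ hn
      rw [hk1] at h2 ⊢
      linarith)
  exact SimpleGraph.ContainsRegularSubgraph.of_edges a b c ha hb (fun i => i.2.2.1) hinj F hF hFd

/-! ### Choice of constants and conclusion -/

theorem SimpleGraph.containsRegularSubgraph_zero {V : Type*} [Nonempty V] (G : SimpleGraph V) :
    G.ContainsRegularSubgraph 0 := by
  classical
  obtain ⟨v⟩ := ‹Nonempty V›
  refine ⟨G.singletonSubgraph v, ⟨v, rfl⟩, fun u => ⟨∅, fun ⟨t, ht⟩ => ?_⟩, fun u => rfl⟩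
  exact absurd ht (by simp [SimpleGraph.Subgraph.coe])

theorem theorem1p11 (lam : ℝ) (hlam : 1 ≤ lam) :
    ∃ c : ℝ, 0 < c ∧
      ∀ (V : Type*) [Fintype V] [Nonempty V] (G : SimpleGraph V) [DecidableRel G.Adj],
        (G.maxDegree : ℝ) ≤ lam * G.avgDegree →
          ∀ r : ℕ, (r : ℝ) ≤ c * G.avgDegree → G.ContainsRegularSubgraph r := by
  -- The cut has average degree at least `d / 2`; cleaning with `α = d / 4` leaves minimum degree `d
  -- / 8 = κ * (lam * d)`.
  set κ : ℝ := 1 / (8 * lam) with hκ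
  have hlam0 : 0 < lam := by linarith
  have hκ0 : 0 < κ := by positivity
  have hκ1 : κ ≤ 1 := (div_le_one (by positivity)).2 (by linarith)
  set S : ℝ := 100 / κ ^ 3 * (200 / κ ^ 2) ^ 2 with hS
  -- Dominates the weight bound, the average defect and the threshold on `D` at once.
  set A : ℝ := 2 / κ ^ 2 + S + (200 / κ ^ 2) ^ 4 with hA
  have hS0 : 0 < S := by positivity
  have hL0 : 0 < 2 / κ ^ 2 := by positivity
  have hE0 : 0 < (200 / κ ^ 2) ^ 4 := by positivity
  have hA0 : 0 < A := by positivity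
  refine ⟨1 / (4 * A), by positivity, ?_⟩
  intro V _ _ G _ hmax r hr
  classical
  rcases Nat.eq_zero_or_pos r with rfl | hr0
  · exact G.containsRegularSubgraph_zero
  set d := G.avgDegree with hd
  have hr1 : (1 : ℝ) ≤ r := by exact_mod_cast hr0
  have hrd : 4 * r * A ≤ d := by
    rw [one_div_mul_eq_div, le_div_iff₀ (by positivity)] at hr; linarith
  -- Since `r ≥ 1`, the bound on `r` already forces `d` to be large.
  have hAd : A ≤ d := by nlinarith
  have hd0 : 0 < d := hA0.trans_le hAd
  have hdD : d ≤ lam * d := le_mul_of_one_le_left hd0.le hlam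
  have hn : (0 : ℝ) < Fintype.card V := by exact_mod_cast Fintype.card_pos
  let e : V → V → ℝ := fun x y => if G.Adj x y then 1 else 0
  have hedeg : ∀ x, ∑ y, e x y = G.degree x := fun x => by
    simp only [e, Finset.sum_boole, ← SimpleGraph.card_neighborFinset_eq_degree,
      SimpleGraph.neighborFinset_eq_filter]
  have hesum : ∑ x, ∑ y, e x y = d * Fintype.card V := by
    simp only [hedeg, hd, SimpleGraph.avgDegree]
    rw [div_mul_cancel₀ _ hn.ne']
  obtain ⟨c, hc⟩ := exists_cut e (fun x => by simp [e])
  let w : V → V → ℝ := fun x y => if c x = c y then 0 else e x y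
  have hw : IsEdgeWeighting (fun x y => G.Adj x y ∧ c x ≠ c y) w 1 := by
    refine ⟨fun x y => ?_, fun x y => ?_, fun x y => ?_, fun x y h => ?_⟩
    · simp only [w, e, eq_comm (a := c x), G.adj_comm x]
    · simp only [w, e]; split_ifs <;> norm_num
    · simp only [w, e]; split_ifs <;> norm_num
    · simp only [w, e] at h
      split_ifs at h with h1 h2
      · exact absurd rfl h
      · exact ⟨h2, h1⟩
      · exact absurd rfl h
  obtain ⟨U, hU, hUd⟩ := exists_le_weightedDegree w hw.symm (fun x => by simp [w]) (d / 4) (by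
    have : (∑ x, ∑ y, e x y) / 2 ≤ ∑ x, ∑ y, w x y := hc
    rw [hesum] at this
    have := mul_pos hd0 hn
    linarith)
  obtain ⟨U', w', h1, h2, h3, h4⟩ := exists_bounded_defect
    (r := fun x y => G.Adj x y ∧ c x ≠ c y) (fun x h => G.loopless.irrefl x h.1) hw hU
    (D := lam * d) hκ0 hκ1 (by linarith) (fun x _ => by
      refine le_trans ?_ hmax
      calc weightedDegree w U x ≤ ∑ y, w x y :=
            Finset.sum_le_sum_of_subset_of_nonneg (Finset.subset_univ U)
              fun y _ _ => hw.nonneg x y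
        _ ≤ ∑ y, e x y := Finset.sum_le_sum fun y _ => by
            simp only [w, e]; split_ifs <;> norm_num
        _ = G.degree x := hedeg x
        _ ≤ G.maxDegree := by exact_mod_cast G.degree_le_maxDegree x)
    (fun x hx => by
      refine le_trans (le_of_eq ?_) (hUd x hx)
      rw [hκ]; field_simp; norm_num)
  exact SimpleGraph.ContainsRegularSubgraph.of_weighting c h2 h1 h3 h4 hA0 (by linarith)
    (by linarith) hr0 (by linarith)
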